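/- **Setting.** Let $A$ be a finite or countably infinite alphabet, $\mathcal W$ the set of words over $A$ (including the empty word $\emptyset$), $d\ge 0$, and $\nu_{j,\ell}\in\mathbb C$ ($1\le j\le d$, $\ell\in A$). For $v\in\mathbb C^d$ and $w=\ell_1\cdots\ell_n\in\mathcal W$ put $\nu^v_w=\sum_{j=1}^d v_j(\nu_{j,\ell_1}+\cdots+\nu_{j,\ell_n})$. On $\mathbb C^{\mathcal W}$ let $(\delta\star\delta')_{\ell_1\cdots\ell_n}=\sum_{j=0}^n\delta_{\ell_1\cdots\ell_j}\delta'_{\ell_{j+1}\cdots\ell_n}$, with unit $1\!\!1$ ($1\!\!1_\emptyset=1$, $1\!\!1_w=0$ for $w\ne\emptyset$), and $(\Xi_v\delta)_w=\exp(\nu^v_w)\,\delta_w$. Let $\mathcal G$ be the group (for $\star$) of all $\gamma\in\mathbb C^{\mathcal W}$ with $\gamma_\emptyset=1$ that satisfy the shuffle relations: $\gamma_w\gamma_{w'}=\sum_j\gamma_{w_j}$ whenever the shuffle product of $w$ and $w'$ is $\sum_j w_j$. Let $\overline{\mathcal G}=\mathbb C^d\times\mathcal G$ with the product $(u,\gamma)\bigstar(v,\delta)=(v+\delta_\emptyset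 u,\ \gamma\star\Xi_u\delta)$. Let $g_1,\dots,g_d$ be linearly independent commuting smooth (that is, holomorphic) vector fields on $\mathbb C^D$ and $f_\ell$, $\ell\in A$, smooth vector fields on $\mathbb C^D$ with $[g_j,f_\ell]=\nu_{j,\ell}f_\ell$ for all $j,\ell$, where $[g,f]=f'g-g'f$. Assume that for each $v\in\mathbb C^d$ the flow of $g^v=\sum_j v_jg_j$ is defined for all real times on all of $\mathbb C^D$ by smooth maps, and let $\varphi_v$ be its time-$1$ map. Put $f_\emptyset(x)=x$ and $f_{\ell_1\cdots\ell_n}(x)=f_{\ell_2\cdots\ell_n}'(x)f_{\ell_1}(x)$. The word series $W_\delta(x)=\sum_{w\in\mathcal W}\delta_wf_w(x)$ and the extended word series $\overline W_{(v,\delta)}(x)=\varphi_v(W_\delta(x))$ are formal series: $f_\ell$ is understood as $\varepsilon_\ell f_\ell$ with commuting formal parameters $\varepsilon_\ell$, $\ell\in A$, series are power series in these parameters whose coefficients are maps $\mathbb C^D\to\mathbb C^D$, and they are composed by substitution in Taylor expansions. **Theorem.** Given $(v,\eta)\in\overline{\mathcal G}$, there is $\kappa\in\mathcal G$, depending only on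 $A$, $(\nu_{j,\ell})$, $v$ and $\eta$, such that the element $\widehat\eta\in\mathcal G$ given by $$(v,\widehat\eta)=(0,\kappa)\bigstar(v,\eta)\bigstar(0,\kappa)^{-1}=\bigl(v,\ \kappa\star\eta\star\Xi_v\kappa^{-1}\bigr)$$ satisfies $\Xi_v\widehat\eta=\widehat\eta$. Moreover, for all $g_j$, $f_\ell$ as above, $\overline W_{(v,\eta)}$ is conjugate through the invertible transformation $x=W_\kappa(X)$ (with inverse $W_{\kappa^{-1}}$) to $\overline W_{(v,\widehat\eta)}$, that is, $\overline W_{(v,\eta)}\circ W_\kappa=W_\kappa\circ\overline W_{(v,\widehat\eta)}$, and $$\overline W_{(v,\widehat\eta)}=\varphi_v\circ W_{\widehat\eta}=W_{\widehat\eta}\circ\varphi_v .$$ Also, $\varphi_u\circ W_{\widehat\eta}=W_{\widehat\eta}\circ\varphi_u$ for every $u\in\mathbb C^d$ such that $\exp(\nu^u_w)=1$ for all $w\in\mathcal W$ with $\exp(\nu^v_w)=1$. -/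

import Mathlib

open scoped ContDiff

noncomputable section

/-! ### Words, convolution, the shuffle group

Words over the alphabet `A` are lists; families of coefficients are functions `List A → ℂ`. -/

/-- The shuffle product of two words, as the list (with repetitions) of the words in the sum. -/
def shuffle {A : Type*} : List A → List A → List (List A)
  | [], w => [w]
  | a :: u, [] => [a :: u]
  | a :: u, b :: w =>
      (shuffle u (b :: w)).map (a :: ·) ++ (shuffle (a :: u) w).map (b :: ·)
termination_by u w => u.length + w.length

/-- The convolution product `δ ⋆ δ'`. -/
def conv {A : Type*} (δ δ' : List A → ℂ) : List A → ℂ :=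
  fun w => ∑ j ∈ Finset.range (w.length + 1), δ (w.take j) * δ' (w.drop j)

/-- The unit of the convolution product. -/
def convOne {A : Type*} : List A → ℂ
  | [] => 1
  | _ :: _ => 0

/-- The group `𝒢`: the families of coefficients that satisfy the shuffle relations. -/
def shuffleGroup (A : Type*) : Set (List A → ℂ) :=
  {γ | γ [] = 1 ∧ ∀ w w' : List A, γ w * γ w' = ((shuffle w w').map γ).sum}

/-- The exponent `ν^v_w = ∑_j v_j (ν_{j,ℓ₁} + ⋯ + ν_{j,ℓₙ})` of a word `w = ℓ₁⋯ℓₙ`. -/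
def nuWord {A : Type*} {d : ℕ} (ν : Fin d → A → ℂ) (v : Fin d → ℂ) (w : List A) : ℂ :=
  (w.map fun ℓ => ∑ j, v j * ν j ℓ).sum

/-- The diagonal operator `Ξ_v`. -/
def Xi {A : Type*} {d : ℕ} (ν : Fin d → A → ℂ) (v : Fin d → ℂ) (δ : List A → ℂ) : List A → ℂ :=
  fun w => Complex.exp (nuWord ν v w) * δ w

/-- The product `(u,γ) ★ (v,δ) = (v + δ_∅ u, γ ⋆ Ξ_u δ)`. -/
def extMul {A : Type*} {d : ℕ} (ν : Fin d → A → ℂ)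
    (p q : (Fin d → ℂ) × (List A → ℂ)) : (Fin d → ℂ) × (List A → ℂ) :=
  (q.1 + q.2 [] • p.1, conv p.2 (Xi ν p.1 q.2))

/-! ### Formal series of maps

Each letter `ℓ` carries a formal parameter `ε_ℓ` (that is, `f_ℓ` stands for `ε_ℓ f_ℓ`); the parameters
commute.  A formal series of maps is a power series in the parameters whose coefficients are maps
`E → E`; `Φ m` is the coefficient of the monomial `ε ^ m`, `m : A →₀ ℕ`.  Only finitely many words
contribute to each monomial, also over an infinite alphabet. -/

/-- Formal series `Φ(x) = ∑_m ε^m Φ_m(x)` of maps from `E` to `E`. -/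
abbrev FormalMap (A E : Type*) := (A →₀ ℕ) → E → E

namespace FormalMap

/-- A map, seen as a formal series without terms of positive degree. -/
def const {A E : Type*} [DecidableEq A] [Zero E] (h : E → E) : FormalMap A E :=
  fun m x => if m = 0 then h x else 0

/-- The coefficient of `ε^q` in `h(Ψ(x))`, where `Ψ(x) = Ψ_0(x) + ∑_{m ≠ 0} ε^m Ψ_m(x)` is
substituted in the Taylor series of `h` at `Ψ_0(x)`:
`h(Ψ(x)) = ∑_k (1/k!) h^{(k)}(Ψ_0(x)) [Ψ(x) - Ψ_0(x), …, Ψ(x) - Ψ_0(x)]`. -/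
def substCoeff {A E : Type*} [DecidableEq A] [NormedAddCommGroup E] [NormedSpace ℂ E]
    (h : E → E) (Ψ : FormalMap A E) (q : A →₀ ℕ) (x : E) : E :=
  ∑ k ∈ Finset.range (q.degree + 1), (k.factorial : ℂ)⁻¹ •
    ∑ r ∈ (Finset.piAntidiag (Finset.univ : Finset (Fin k)) q).filter (fun r => ∀ i, r i ≠ 0),
      iteratedFDeriv ℂ k h (Ψ 0 x) (fun i => Ψ (r i) x)

/-- The composition `Φ ∘ Ψ` of formal series of maps. -/
def comp {A E : Type*} [DecidableEq A] [NormedAddCommGroup E] [NormedSpace ℂ E]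
    (Φ Ψ : FormalMap A E) : FormalMap A E :=
  fun m x => ∑ p ∈ Finset.HasAntidiagonal.antidiagonal m, substCoeff (Φ p.1) Ψ p.2 x

end FormalMap

/-! ### Word series and extended word series -/

/-- The word basis functions: `f_∅ = id`, `f_{ℓ₁⋯ℓₙ}(x) = f'_{ℓ₂⋯ℓₙ}(x) f_{ℓ₁}(x)`; for a word
of one letter the formula gives `f_ℓ`, see `wordBasis_singleton`. -/
def wordBasis {A E : Type*} [NormedAddCommGroup E] [NormedSpace ℂ E] (f : A → E → E) :
    List A → E → E
  | [] => fun x => x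
  | ℓ :: w => fun x => fderiv ℂ (wordBasis f w) x (f ℓ x)

theorem wordBasis_singleton {A E : Type*} [NormedAddCommGroup E] [NormedSpace ℂ E]
    (f : A → E → E) (ℓ : A) : wordBasis f [ℓ] = f ℓ := by
  funext x
  simp [wordBasis]

/-- The word series `W_δ(x) = ∑_w δ_w f_w(x)`: the coefficient of `ε^m` is the sum of `δ_w f_w`
over the words `w` in which each letter `ℓ` occurs `m ℓ` times. -/
def wordSeries {A E : Type*} [DecidableEq A] [NormedAddCommGroup E] [NormedSpace ℂ E]
    (f : A → E → E) (δ : List A → ℂ) : FormalMap A E :=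
  fun m x => ∑ w ∈ (Finsupp.toMultiset m).lists.toFinset, δ w • wordBasis f w x

/-- The extended word series `W̄_{(v,δ)}(x) = φ_v(W_δ(x))`. -/
def extWordSeries {A E : Type*} [DecidableEq A] [NormedAddCommGroup E] [NormedSpace ℂ E] {d : ℕ}
    (φ : (Fin d → ℂ) → E → E) (f : A → E → E) (p : (Fin d → ℂ) × (List A → ℂ)) :
    FormalMap A E :=
  FormalMap.comp (FormalMap.const (φ p.1)) (wordSeries f p.2)

/-! ### The vector fields and their flows -/

/-- The vector field `g^v = ∑_j v_j g_j`. -/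
def linComb {E : Type*} [NormedAddCommGroup E] [NormedSpace ℂ E] {d : ℕ}
    (g : Fin d → E → E) (v : Fin d → ℂ) : E → E :=
  fun x => ∑ j, v j • g j x

/-- `g_1, …, g_d` are linearly independent commuting smooth vector fields and each smooth field
`f_ℓ` is an eigenvector of each `[g_j, ·]` with eigenvalue `ν_{j,ℓ}`.  The bracket is
`[g, f] = f' g - g' f`. -/
structure IsPerturbedSystem {A E : Type*} [NormedAddCommGroup E] [NormedSpace ℂ E] {d : ℕ}
    (ν : Fin d → A → ℂ) (g : Fin d → E → E) (f : A → E → E) : Prop where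
  smooth_g : ∀ j, ContDiff ℂ ∞ (g j)
  smooth_f : ∀ ℓ, ContDiff ℂ ∞ (f ℓ)
  linearIndependent : LinearIndependent ℂ g
  commute : ∀ j k, VectorField.lieBracket ℂ (g j) (g k) = 0
  eigen : ∀ j ℓ, VectorField.lieBracket ℂ (g j) (f ℓ) = ν j ℓ • f ℓ

/-- `φ_v` is the (smooth) flow at time `1` of `g^v`, for every `v`: the flow of `g^v` at time `t`
is `φ_{tv}`. -/
structure IsFlowFamily {E : Type*} [NormedAddCommGroup E] [NormedSpace ℂ E] {d : ℕ}
    (g : Fin d → E → E) (φ : (Fin d → ℂ) → E → E) : Prop where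
  smooth : ∀ v, ContDiff ℂ ∞ (φ v)
  map_zero : ∀ x, φ 0 x = x
  integralCurve : ∀ v x, IsIntegralCurve (fun t : ℝ => φ ((t : ℂ) • v) x) (fun _ => linComb g v)

end

/-! Write `E_ℓ h = h' f_ℓ` and let `E_w` be the composite of these operators along the word `w`
(`wordOp`). For `γ` in the shuffle group, substitution of a word series is given by these operators:
`h(W_γ(x)) = ∑_w γ_w (E_w h)(x)` (`substCoeff_opSeries`). Indeed, the Taylor expansion of the left
side contains products `γ_{t_0} ⋯ γ_{t_{k-1}}`, which the shuffle relations turn into sums of single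
coefficients, while the iterated chain rule `wordOp_comp` distributes the letters of `w` among `k`
subwords in all ways. The two expansions agree because shuffling and unshuffling are dual
(`unshuffleSum_ite`, `sum_piFinset_wordsOf`).

The relation `[g^v, f_ℓ] = ν^v_ℓ f_ℓ` integrates to `f_ℓ(φ_v(x)) = exp(ν^v_ℓ) φ_v'(x) f_ℓ(x)`
(`IsPerturbedSystem.apply_flow`), so moving `φ_v` through a word series applies `Ξ_v` to its
coefficients. Both sides of the conjugacy thus become series `∑_w c_w E_w φ_v`, with `c = κ ⋆ η` and
`c = η̂ ⋆ Ξ_v κ` respectively. Everything reduces to the algebraic equation `η̂ ⋆ Ξ_v κ = κ ⋆ η` in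
the shuffle group, with `η̂` supported on the resonant words, those with `exp(ν^v_w) = 1`. Such an
`η̂` is fixed by `Ξ_v`, and by every `Ξ_u` that is trivial on resonant words, which gives the
commutation statements.

The equation is solved length by length (`exists_resonant_normalForm`). If nonresonant terms are
already absent up to length `n`, the choice `κ_w = η_w / (exp(ν^v_w) - 1)` on nonresonant words of
length `n + 1` removes the next ones; `gradedExp` extends it to an element of the group, and the
successive corrections stabilize at each word. -/

noncomputable section

/-! ### Sums over shuffles and the group structure of `shuffleGroup` -/

section Words

variable {A : Type*}

/-- The linear extension of `α`, evaluated at the shuffle product of `u` and `w`. -/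
def shuffleSum (α : List A → ℂ) (u w : List A) : ℂ := ((shuffle u w).map α).sum

@[simp] theorem shuffleSum_nil_left (α : List A → ℂ) (w : List A) : shuffleSum α [] w = α w := by
  simp [shuffleSum, shuffle]

@[simp] theorem shuffleSum_nil_right (α : List A → ℂ) (u : List A) : shuffleSum α u [] = α u := by
  cases u <;> simp [shuffleSum, shuffle]

theorem shuffleSum_cons_cons (α : List A → ℂ) (a b : A) (u w : List A) :
    shuffleSum α (a :: u) (b :: w) =
      shuffleSum (fun s => α (a :: s)) u (b :: w) + shuffleSum (fun s => α (b :: s)) (a :: u) w := by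
  simp [shuffleSum, shuffle, Function.comp_def]

theorem shuffleSum_add (α β : List A → ℂ) (u w : List A) :
    shuffleSum (fun s => α s + β s) u w = shuffleSum α u w + shuffleSum β u w := by
  simp [shuffleSum, List.sum_map_add]

theorem shuffleSum_mul_left (c : ℂ) (α : List A → ℂ) (u w : List A) :
    shuffleSum (fun s => c * α s) u w = c * shuffleSum α u w := by
  simp [shuffleSum, List.sum_map_mul_left]

/-- Length, letter content and `ν^v` are therefore constant on all words of a shuffle and can be
pulled out of `shuffleSum`. -/
theorem perm_append_of_mem_shuffle {u w s : List A} (h : s ∈ shuffle u w) : s.Perm (u ++ w) := by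
  induction u generalizing w s with
  | nil =>
    simp [shuffle] at h
    simp [h]
  | cons a u ihu =>
    induction w generalizing s with
    | nil =>
      simp [shuffle] at h
      simp [h]
    | cons b w ihw =>
      simp only [shuffle, List.mem_append, List.mem_map] at h
      rcases h with ⟨t, ht, rfl⟩ | ⟨t, ht, rfl⟩
      · exact (ihu ht).cons a
      · exact ((ihw ht).cons b).trans List.perm_middle.symm

theorem shuffleSum_congr {α β : List A → ℂ} {u w : List A}
    (h : ∀ s, s.Perm (u ++ w) → α s = β s) : shuffleSum α u w = shuffleSum β u w := by
  unfold shuffleSum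
  rw [List.map_congr_left fun s hs => h s (perm_append_of_mem_shuffle hs)]

theorem mem_shuffleGroup {γ : List A → ℂ} :
    γ ∈ shuffleGroup A ↔ γ [] = 1 ∧ ∀ u w, shuffleSum γ u w = γ u * γ w :=
  ⟨fun h => ⟨h.1, fun u w => (h.2 u w).symm⟩, fun h => ⟨h.1, fun u w => (h.2 u w).symm⟩⟩

@[simp] theorem conv_nil (δ δ' : List A → ℂ) : conv δ δ' [] = δ [] * δ' [] := by
  simp [conv]

theorem conv_cons (δ δ' : List A → ℂ) (a : A) (w : List A) :
    conv δ δ' (a :: w) = δ [] * δ' (a :: w) + conv (fun s => δ (a :: s)) δ' w := by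
  simp only [conv, List.length_cons]
  rw [Finset.sum_range_succ', add_comm]
  simp

theorem conv_add_left (α β δ : List A → ℂ) (w : List A) :
    conv (fun s => α s + β s) δ w = conv α δ w + conv β δ w := by
  simp [conv, add_mul, Finset.sum_add_distrib]

theorem conv_mul_left (c : ℂ) (α δ : List A → ℂ) (w : List A) :
    conv (fun s => c * α s) δ w = c * conv α δ w := by
  simp [conv, mul_assoc, Finset.mul_sum]

theorem conv_assoc (α β δ : List A → ℂ) : conv (conv α β) δ = conv α (conv β δ) := by
  funext w
  induction w generalizing α with
  | nil => simp [mul_assoc]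
  | cons a w ih =>
    simp only [conv_cons, conv_nil, conv_add_left, conv_mul_left]
    rw [ih]
    ring

theorem convOne_conv (δ : List A → ℂ) : conv convOne δ = δ := by
  funext w
  cases w with
  | nil => simp [convOne]
  | cons a w =>
    rw [conv_cons]
    simp [convOne, conv]

theorem conv_convOne (δ : List A → ℂ) : conv δ convOne = δ := by
  funext w
  induction w generalizing δ with
  | nil => simp [convOne]
  | cons a w ih => simp [conv_cons, convOne, ih]

theorem conv_eq_sum_fin_add (δ δ' : List A → ℂ) (w : List A) :
    conv δ δ' w = (∑ j : Fin w.length, δ (w.take j) * δ' (w.drop j)) + δ w * δ' [] := by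
  rw [conv, Finset.sum_range_succ, Finset.sum_range]
  simp

/-- `conv δ δ' w` depends only on the values of `δ` and `δ'` at words not longer than `w`. -/
theorem conv_congr {α α' β β' : List A → ℂ} {w : List A}
    (hα : ∀ s : List A, s.length ≤ w.length → α s = α' s)
    (hβ : ∀ s : List A, s.length ≤ w.length → β s = β' s) : conv α β w = conv α' β' w := by
  unfold conv
  refine Finset.sum_congr rfl fun j _ => ?_
  rw [hα _ (by simp), hβ _ (by simp)]

/-- Deconcatenation is compatible with shuffles. -/
theorem shuffleSum_conv (α β : List A → ℂ) (u w : List A) :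
    shuffleSum (conv α β) u w =
      ∑ i ∈ Finset.range (u.length + 1), ∑ j ∈ Finset.range (w.length + 1),
        shuffleSum α (u.take i) (w.take j) * shuffleSum β (u.drop i) (w.drop j) := by
  induction u generalizing α w with
  | nil => simp [conv]
  | cons a u ihu =>
    induction w generalizing α with
    | nil => simp [conv]
    | cons b w ihw =>
      rw [shuffleSum_cons_cons]
      simp only [conv_cons, shuffleSum_add, shuffleSum_mul_left, ihu, ihw]
      simp only [List.length_cons, Finset.sum_range_succ' _ (w.length + 1),
        Finset.sum_range_succ' _ (u.length + 1), List.take_succ_cons, List.drop_succ_cons,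
        List.take_zero, List.drop_zero, shuffleSum_nil_left, shuffleSum_nil_right,
        shuffleSum_cons_cons, Finset.sum_add_distrib, add_mul]
      ring

theorem conv_mem_shuffleGroup {α β : List A → ℂ} (hα : α ∈ shuffleGroup A)
    (hβ : β ∈ shuffleGroup A) : conv α β ∈ shuffleGroup A := by
  rw [mem_shuffleGroup] at *
  refine ⟨by simp [hα.1, hβ.1], fun u w => ?_⟩
  rw [shuffleSum_conv]
  simp only [conv, Finset.sum_mul_sum, hα.2, hβ.2]
  exact Finset.sum_congr rfl fun i _ => Finset.sum_congr rfl fun j _ => by ring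

theorem convOne_mem_shuffleGroup : (convOne : List A → ℂ) ∈ shuffleGroup A := by
  refine mem_shuffleGroup.2 ⟨rfl, fun u w => ?_⟩
  cases u with
  | nil => simp [convOne]
  | cons a u =>
    cases w with
    | nil => simp [convOne]
    | cons b w =>
      rw [shuffleSum_cons_cons]
      simp [convOne, shuffleSum]

/-! ### Convolution inverses. -/

/-- The left inverse of `γ` for the convolution product, when `γ [] = 1`. -/
def convInv (γ : List A → ℂ) (w : List A) : ℂ :=
  convOne w - ∑ j : Fin w.length, convInv γ (w.take j) * γ (w.drop j)
termination_by w.length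
decreasing_by simp

theorem convInv_conv {γ : List A → ℂ} (h : γ [] = 1) : conv (convInv γ) γ = convOne := by
  funext w
  rw [conv_eq_sum_fin_add, h]
  conv_lhs => rw [convInv.eq_def γ w]
  ring

@[simp] theorem convInv_nil (γ : List A → ℂ) : convInv γ [] = 1 := by
  rw [convInv]
  simp [convOne]

/-- Every left inverse again has a left inverse, so left inverses are two-sided. -/
theorem conv_convInv {γ : List A → ℂ} (h : γ [] = 1) : conv γ (convInv γ) = convOne := by
  have h1 := convInv_conv h
  have h2 := convInv_conv (convInv_nil γ)
  calc conv γ (convInv γ)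
      = conv (conv (convInv (convInv γ)) (convInv γ)) (conv γ (convInv γ)) := by
        rw [h2, convOne_conv]
    _ = convOne := by
        rw [conv_assoc, ← conv_assoc (convInv γ) γ, h1, convOne_conv, h2]

/-- Both `shuffleSum (convInv γ)` and the product of the values of `convInv γ` satisfy the same
triangular system, because `convOne` and `γ` are characters; induction on the total length
identifies them. -/
theorem convInv_mem_shuffleGroup {γ : List A → ℂ} (hγ : γ ∈ shuffleGroup A) :
    convInv γ ∈ shuffleGroup A := by
  rw [mem_shuffleGroup] at *
  refine ⟨convInv_nil γ, fun u w => ?_⟩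
  induction hn : u.length + w.length using Nat.strong_induction_on generalizing u w with
  | _ n ih =>
  have h1 := shuffleSum_conv (convInv γ) γ u w
  have h2 : ∑ i ∈ Finset.range (u.length + 1), ∑ j ∈ Finset.range (w.length + 1),
      (convInv γ (u.take i) * convInv γ (w.take j)) * shuffleSum γ (u.drop i) (w.drop j) =
      convOne u * convOne w := by
    rw [← convInv_conv hγ.1]
    simp only [conv, Finset.sum_mul_sum, hγ.2]
    exact Finset.sum_congr rfl fun i _ => Finset.sum_congr rfl fun j _ => by ring
  rw [convInv_conv hγ.1, (mem_shuffleGroup.1 convOne_mem_shuffleGroup).2, ← h2,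
    ← sub_eq_zero, ← Finset.sum_sub_distrib] at h1
  simp only [← Finset.sum_sub_distrib, ← sub_mul] at h1
  -- By induction only the pair of full prefixes can contribute; its other factor is `γ [] = 1`.
  rw [Finset.sum_eq_single u.length, Finset.sum_eq_single w.length] at h1
  · simp only [List.take_length, List.drop_length, shuffleSum_nil_left, hγ.1, mul_one] at h1
    linear_combination -h1
  · intro j hj hj'
    rw [Finset.mem_range] at hj
    rw [ih _ _ _ _ rfl, sub_self, zero_mul]
    simp
    omega
  · simp
  · intro i hi hi'
    rw [Finset.mem_range] at hi
    refine Finset.sum_eq_zero fun j hj => ?_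
    rw [ih _ _ _ _ rfl, sub_self, zero_mul]
    simp
    omega
  · simp

/-! ### Elements of the shuffle group from infinitesimal characters -/

/-- The solution of `|w| γ_w = (γ ⋆ b)_w`, `γ_∅ = 1`. -/
def gradedExp (b : List A → ℂ) (w : List A) : ℂ :=
  convOne w + (w.length : ℂ)⁻¹ * ∑ j : Fin w.length, gradedExp b (w.take j) * b (w.drop j)
termination_by w.length
decreasing_by simp

@[simp] theorem gradedExp_nil (b : List A → ℂ) : gradedExp b [] = 1 := by
  rw [gradedExp]
  simp [convOne]

theorem length_mul_gradedExp {b : List A → ℂ} (hb : b [] = 0) (w : List A) :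
    (w.length : ℂ) * gradedExp b w = conv (gradedExp b) b w := by
  rw [conv_eq_sum_fin_add, hb]
  cases w with
  | nil => simp
  | cons a w =>
    have : (((a :: w).length : ℕ) : ℂ) ≠ 0 := by simpa using Nat.cast_add_one_ne_zero w.length
    conv_lhs => rw [gradedExp]
    simp only [convOne, zero_add, mul_zero, add_zero]
    rw [mul_inv_cancel_left₀ this]

/-- Multiplication by the length is a derivation for the shuffle product, and `b` vanishes on proper
shuffles. Hence `n γ(u ⧢ w)` and `n γ_u γ_w`, with `n = |u| + |w|`, have the same expression in
terms of shorter words. -/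
theorem gradedExp_mem_shuffleGroup {b : List A → ℂ} (hb : b [] = 0)
    (hb' : ∀ u w : List A, u ≠ [] → w ≠ [] → shuffleSum b u w = 0) :
    gradedExp b ∈ shuffleGroup A := by
  refine mem_shuffleGroup.2 ⟨gradedExp_nil b, fun u w => ?_⟩
  induction hn : u.length + w.length using Nat.strong_induction_on generalizing u w with
  | _ n ih =>
  rcases eq_or_ne u [] with rfl | hu
  · simp
  rcases eq_or_ne w [] with rfl | hw
  · simp
  -- A pair of suffixes contributes only if one of them is empty.
  have hsplit : ∀ i ∈ Finset.range (u.length + 1), ∀ j ∈ Finset.range (w.length + 1),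
      shuffleSum b (u.drop i) (w.drop j) =
        (if j = w.length then b (u.drop i) else 0) + (if i = u.length then b (w.drop j) else 0) := by
    intro i hi j hj
    rw [Finset.mem_range] at hi hj
    split_ifs with h1 h2 h2
    · simp [h1, h2, hb]
    · simp [h1]
    · simp [h2]
    · rw [hb', add_zero] <;> simp <;> omega
  have hlen : (n : ℂ) * shuffleSum (gradedExp b) u w = shuffleSum (conv (gradedExp b) b) u w := by
    rw [← shuffleSum_mul_left]
    refine shuffleSum_congr fun s hs => ?_
    rw [← length_mul_gradedExp hb, hs.length_eq, List.length_append, hn]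
  have hu' : ∑ i ∈ Finset.range (u.length + 1),
      shuffleSum (gradedExp b) (u.take i) w * b (u.drop i) =
      conv (gradedExp b) b u * gradedExp b w := by
    rw [conv, Finset.sum_mul]
    refine Finset.sum_congr rfl fun i hi => ?_
    rw [Finset.mem_range] at hi
    rcases eq_or_ne i u.length with rfl | hi'
    · simp [hb]
    · rw [ih _ _ _ _ rfl]
      · ring
      · simp; omega
  have hw' : ∑ j ∈ Finset.range (w.length + 1),
      shuffleSum (gradedExp b) u (w.take j) * b (w.drop j) =
      gradedExp b u * conv (gradedExp b) b w := by
    rw [conv, Finset.mul_sum]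
    refine Finset.sum_congr rfl fun i hi => ?_
    rw [Finset.mem_range] at hi
    rcases eq_or_ne i w.length with rfl | hi'
    · simp [hb]
    · rw [ih _ _ _ _ rfl]
      · ring
      · simp; omega
  have hn0 : (n : ℂ) ≠ 0 := by
    have := List.length_pos_iff.2 hu
    exact_mod_cast (by omega : n ≠ 0)
  apply mul_left_cancel₀ hn0
  rw [hlen, shuffleSum_conv, Finset.sum_congr rfl fun i hi => Finset.sum_congr rfl fun j hj => by
    rw [hsplit i hi j hj]]
  simp only [mul_add, Finset.sum_add_distrib, mul_ite, mul_zero, Finset.sum_ite_eq',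
    Finset.mem_range, Nat.lt_succ_self, if_true, List.take_length]
  rw [Finset.sum_comm (s := Finset.range (u.length + 1))]
  simp only [Finset.sum_ite_eq', Finset.mem_range, Nat.lt_succ_self, if_true, List.take_length]
  rw [hu', hw', ← length_mul_gradedExp hb, ← length_mul_gradedExp hb, ← hn]
  push_cast
  ring

end Words

/-! ### The operators `Ξ_v` and the resonant normal form -/

section NormalForm

variable {A : Type*} {d : ℕ}

@[simp] theorem nuWord_nil (ν : Fin d → A → ℂ) (v : Fin d → ℂ) : nuWord ν v [] = 0 := by
  simp [nuWord]

theorem nuWord_append (ν : Fin d → A → ℂ) (v : Fin d → ℂ) (u w : List A) :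
    nuWord ν v (u ++ w) = nuWord ν v u + nuWord ν v w := by
  simp [nuWord]

theorem nuWord_perm (ν : Fin d → A → ℂ) (v : Fin d → ℂ) {u w : List A} (h : u.Perm w) :
    nuWord ν v u = nuWord ν v w :=
  (h.map _).sum_eq

@[simp] theorem Xi_nil (ν : Fin d → A → ℂ) (v : Fin d → ℂ) (δ : List A → ℂ) :
    Xi ν v δ [] = δ [] := by
  simp [Xi]

theorem Xi_zero (ν : Fin d → A → ℂ) (δ : List A → ℂ) : Xi ν 0 δ = δ := by
  funext w
  simp [Xi, nuWord]

theorem Xi_conv (ν : Fin d → A → ℂ) (v : Fin d → ℂ) (α β : List A → ℂ) :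
    Xi ν v (conv α β) = conv (Xi ν v α) (Xi ν v β) := by
  funext w
  simp only [Xi, conv, Finset.mul_sum]
  refine Finset.sum_congr rfl fun j _ => ?_
  rw [← List.take_append_drop j w, nuWord_append, Complex.exp_add, List.take_append_drop]
  ring

theorem Xi_convOne (ν : Fin d → A → ℂ) (v : Fin d → ℂ) : Xi ν v convOne = convOne := by
  funext w
  cases w <;> simp [Xi, convOne]

theorem Xi_mem_shuffleGroup (ν : Fin d → A → ℂ) (v : Fin d → ℂ) {γ : List A → ℂ}
    (hγ : γ ∈ shuffleGroup A) : Xi ν v γ ∈ shuffleGroup A := by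
  rw [mem_shuffleGroup] at *
  refine ⟨by simp [hγ.1], fun u w => ?_⟩
  rw [shuffleSum_congr (β := fun s => Complex.exp (nuWord ν v (u ++ w)) * γ s) fun s hs => by
    rw [Xi, nuWord_perm ν v hs], shuffleSum_mul_left, hγ.2, nuWord_append, Complex.exp_add]
  simp only [Xi]
  ring

/-- When `δ` is trivial below the length of `w`, the convolution at `w` is linear in the first new
coefficient; this and the mirror statement yield the homological equation. -/
theorem conv_of_eq_convOne_left {δ ε : List A → ℂ} {w : List A} (hw : w ≠ [])
    (h : ∀ s : List A, s.length < w.length → δ s = convOne s) :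
    conv δ ε w = ε w + δ w * ε [] := by
  have h1 : convOne w = 0 := by cases w with
    | nil => exact absurd rfl hw
    | cons a w => rfl
  rw [← congrFun (convOne_conv ε) w, conv_eq_sum_fin_add, conv_eq_sum_fin_add, h1,
    zero_mul, add_zero]
  congr 1
  refine Finset.sum_congr rfl fun j _ => ?_
  rw [h _ (by simp)]

theorem conv_of_eq_convOne_right {δ ε : List A → ℂ} {w : List A} (hw : w ≠ [])
    (h : ∀ s : List A, s.length < w.length → δ s = convOne s) :
    conv ε δ w = ε w + ε [] * δ w := by
  have h1 : convOne w = 0 := by cases w with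
    | nil => exact absurd rfl hw
    | cons a w => rfl
  have h2 : conv ε δ w - conv ε convOne w = ε [] * δ w := by
    rw [conv, conv, ← Finset.sum_sub_distrib, Finset.sum_eq_single 0]
    · simp [h1]
    · intro j hj hj0
      have := List.length_pos_iff.2 hw
      rw [h _ (by simp; omega), sub_self]
    · simp
  rw [conv_convOne] at h2
  linear_combination h2

/-- The infinitesimal character that removes the nonresonant terms of `η` of length `n + 1`. -/
def removal (ν : Fin d → A → ℂ) (v : Fin d → ℂ) (η : List A → ℂ) (n : ℕ) (w : List A) : ℂ :=
  if w.length = n + 1 ∧ Complex.exp (nuWord ν v w) ≠ 1 then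
    ((n + 1 : ℕ) : ℂ) / (Complex.exp (nuWord ν v w) - 1) * η w else 0

/-- If `u ++ w` is nonresonant, then `u` or `w` is nonresonant, since `exp(ν^v)` is multiplicative.
Both are shorter than `n + 1`, so `η_u η_w = 0`. -/
theorem shuffleSum_removal (ν : Fin d → A → ℂ) (v : Fin d → ℂ) {η : List A → ℂ}
    (hη : η ∈ shuffleGroup A) {n : ℕ}
    (hres : ∀ w : List A, w.length ≤ n → Complex.exp (nuWord ν v w) ≠ 1 → η w = 0)
    {u w : List A} (hu : u ≠ []) (hw : w ≠ []) : shuffleSum (removal ν v η n) u w = 0 := by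
  by_cases hc : (u ++ w).length = n + 1 ∧ Complex.exp (nuWord ν v (u ++ w)) ≠ 1
  · rw [shuffleSum_congr (β := fun s => ((n + 1 : ℕ) : ℂ) /
        (Complex.exp (nuWord ν v (u ++ w)) - 1) * η s) fun s hs => by
      rw [removal, nuWord_perm ν v hs, hs.length_eq, if_pos hc], shuffleSum_mul_left,
      (mem_shuffleGroup.1 hη).2]
    obtain ⟨h1, h2⟩ := hc
    rw [List.length_append] at h1
    have hu' := List.length_pos_iff.2 hu
    have hw' := List.length_pos_iff.2 hw
    rw [nuWord_append, Complex.exp_add] at h2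
    by_cases h3 : Complex.exp (nuWord ν v u) = 1
    · rw [h3, one_mul] at h2
      rw [hres w (by omega) h2, mul_zero, mul_zero]
    · rw [hres u (by omega) h3, zero_mul, mul_zero]
  · rw [shuffleSum_congr (β := fun s => 0 * η s) fun s hs => by
      rw [removal, nuWord_perm ν v hs, hs.length_eq, if_neg hc, zero_mul], shuffleSum_mul_left,
      zero_mul]

theorem gradedExp_removal_of_le (ν : Fin d → A → ℂ) (v : Fin d → ℂ) (η : List A → ℂ) {n : ℕ}
    {w : List A} (hw : w.length ≤ n) : gradedExp (removal ν v η n) w = convOne w := by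
  rw [gradedExp, Finset.sum_eq_zero, mul_zero, add_zero]
  intro j _
  rw [removal, if_neg, mul_zero]
  simp only [List.length_drop]
  omega

theorem gradedExp_removal_of_eq (ν : Fin d → A → ℂ) (v : Fin d → ℂ) (η : List A → ℂ) {n : ℕ}
    {w : List A} (hw : w.length = n + 1) (hn : Complex.exp (nuWord ν v w) ≠ 1) :
    gradedExp (removal ν v η n) w = (Complex.exp (nuWord ν v w) - 1)⁻¹ * η w := by
  have h0 : removal ν v η n [] = 0 := by simp [removal]
  have hw0 : w ≠ [] := by
    rintro rfl
    simp at hw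
  have h1 := length_mul_gradedExp h0 w
  rw [conv_of_eq_convOne_left hw0 fun s hs => gradedExp_removal_of_le ν v η (by omega), h0,
    mul_zero, add_zero, removal, if_pos ⟨hw, hn⟩, hw, div_eq_mul_inv, mul_assoc] at h1
  -- The factor `n + 1` in `removal` cancels the division by the length in `gradedExp`.
  exact mul_left_cancel₀ (Nat.cast_ne_zero.2 n.succ_ne_zero) h1

theorem exists_remove_nonresonant (ν : Fin d → A → ℂ) (v : Fin d → ℂ) {η : List A → ℂ}
    (hη : η ∈ shuffleGroup A) {n : ℕ}
    (hres : ∀ w : List A, w.length ≤ n → Complex.exp (nuWord ν v w) ≠ 1 → η w = 0) :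
    ∃ κ ∈ shuffleGroup A, ∃ η' ∈ shuffleGroup A,
      (∀ w : List A, w.length ≤ n → κ w = convOne w) ∧
      (∀ w : List A, w.length ≤ n → η' w = η w) ∧
      conv η' (Xi ν v κ) = conv κ η ∧
      ∀ w : List A, w.length ≤ n + 1 → Complex.exp (nuWord ν v w) ≠ 1 → η' w = 0 := by
  set κ := gradedExp (removal ν v η n) with hκ
  have hκG : κ ∈ shuffleGroup A := gradedExp_mem_shuffleGroup (by simp [removal])
    fun u w hu hw => shuffleSum_removal ν v hη hres hu hw
  have hκ1 : ∀ w : List A, w.length ≤ n → κ w = convOne w := fun w hw =>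
    gradedExp_removal_of_le ν v η hw
  have hΞ1 : ∀ w : List A, w.length ≤ n → Xi ν v κ w = convOne w := fun w hw => by
    rw [← Xi_convOne ν v, Xi, hκ1 w hw, Xi]
  set η' := conv (conv κ η) (Xi ν v (convInv κ)) with hη'
  have hη'G : η' ∈ shuffleGroup A := conv_mem_shuffleGroup (conv_mem_shuffleGroup hκG hη)
    (Xi_mem_shuffleGroup ν v (convInv_mem_shuffleGroup hκG))
  have heq : conv η' (Xi ν v κ) = conv κ η := by
    rw [hη', conv_assoc, ← Xi_conv, convInv_conv hκG.1, Xi_convOne, conv_convOne]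
  -- The homological equation: up to length `n + 1`, all mixed terms of `conv η' (Xi ν v κ) = conv κ
  -- η` drop out.
  have hlow : ∀ w : List A, w.length ≤ n + 1 → w ≠ [] →
      η' w + Complex.exp (nuWord ν v w) * κ w = η w + κ w := by
    intro w hw hw0
    have h1 := congrFun heq w
    rw [conv_of_eq_convOne_right hw0 fun s hs => hΞ1 s (by omega),
      conv_of_eq_convOne_left hw0 fun s hs => hκ1 s (by omega), hη'G.1, hη.1, one_mul,
      mul_one] at h1
    exact h1
  have hstable : ∀ w : List A, w.length ≤ n → η' w = η w := by
    intro w hw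
    rcases eq_or_ne w [] with rfl | hw0
    · rw [hη'G.1, hη.1]
    · have h1 := hlow w (by omega) hw0
      have h2 : κ w = 0 := by
        rw [hκ1 w hw]
        cases w with
        | nil => exact absurd rfl hw0
        | cons a w => rfl
      simpa [h2] using h1
  refine ⟨κ, hκG, η', hη'G, hκ1, hstable, heq, fun w hw hn => ?_⟩
  rcases Nat.lt_or_ge n w.length with h | h
  · have hw0 : w ≠ [] := by
      rintro rfl
      simp at h
    have h1 := hlow w hw hw0
    have hwn : w.length = n + 1 := by omega
    have hne := sub_ne_zero.2 hn
    have h2 : (Complex.exp (nuWord ν v w) - 1) * κ w = η w := by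
      rw [hκ, gradedExp_removal_of_eq ν v η hwn hn, mul_inv_cancel_left₀ hne]
    linear_combination h1 - h2
  · rw [hstable w h, hres w h hn]

/-- A sequence in the shuffle group that stabilizes at each word has its limit in the group. -/
theorem mem_shuffleGroup_of_stable {K : ℕ → List A → ℂ} (hK : ∀ n, K n ∈ shuffleGroup A)
    (hst : ∀ n, ∀ w : List A, w.length ≤ n → K n w = K w.length w) :
    (fun w => K w.length w) ∈ shuffleGroup A := by
  refine mem_shuffleGroup.2 ⟨(hK 0).1, fun u w => ?_⟩
  rw [shuffleSum_congr (β := K (u.length + w.length)) fun s hs => ?_,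
    (mem_shuffleGroup.1 (hK _)).2, hst _ u (by omega), hst _ w (by omega)]
  exact (hst _ s (by rw [hs.length_eq, List.length_append])).symm

/-- Every element of the shuffle group can be brought to resonant normal form. -/
theorem exists_resonant_normalForm (ν : Fin d → A → ℂ) (v : Fin d → ℂ) {η : List A → ℂ}
    (hη : η ∈ shuffleGroup A) :
    ∃ κ ∈ shuffleGroup A, ∃ ηhat ∈ shuffleGroup A,
      conv ηhat (Xi ν v κ) = conv κ η ∧
      ∀ w : List A, Complex.exp (nuWord ν v w) ≠ 1 → ηhat w = 0 := by
  let P : ℕ → (List A → ℂ) × (List A → ℂ) → Prop := fun n p =>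
    p.1 ∈ shuffleGroup A ∧ p.2 ∈ shuffleGroup A ∧ conv p.2 (Xi ν v p.1) = conv p.1 η ∧
      ∀ w : List A, w.length ≤ n → Complex.exp (nuWord ν v w) ≠ 1 → p.2 w = 0
  have hstep : ∀ n p, P n p → ∃ q, P (n + 1) q ∧
      ∀ w : List A, w.length ≤ n → q.1 w = p.1 w ∧ q.2 w = p.2 w := by
    rintro n ⟨k, e⟩ ⟨hk, he, heq, hres⟩
    obtain ⟨κ, hκ, η', hη', h1, h2, h3, h4⟩ := exists_remove_nonresonant ν v he hres
    -- Successive conjugations compose by left multiplication, because `Ξ_v` is multiplicative. The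
    -- new factor is trivial up to length `n`, so earlier values survive.
    refine ⟨(conv κ k, η'), ⟨conv_mem_shuffleGroup hκ hk, hη', ?_, h4⟩, fun w hw => ⟨?_, h2 w hw⟩⟩
    · simp only at heq ⊢
      rw [Xi_conv, ← conv_assoc, h3, conv_assoc, heq, conv_assoc]
    · simp only
      rw [conv_congr (fun s hs => h1 s (hs.trans hw)) (fun s _ => rfl), convOne_conv]
  have h0 : P 0 (convOne, η) := by
    refine ⟨convOne_mem_shuffleGroup, hη, ?_, fun w hw hn => ?_⟩
    · simp only
      rw [Xi_convOne, conv_convOne, convOne_conv]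
    -- The empty word is resonant, so nothing has to be removed at length zero.
    · rw [List.length_eq_zero_iff.1 (Nat.le_zero.1 hw)] at hn
      simp at hn
  choose! next hnext using hstep
  let S : ℕ → (List A → ℂ) × (List A → ℂ) := fun n => Nat.rec (convOne, η) (fun n p => next n p) n
  have hS : ∀ n, P n (S n) := by
    intro n
    induction n with
    | zero => exact h0
    | succ n ih => exact (hnext n _ ih).1
  have hst : ∀ n, ∀ w : List A, w.length ≤ n →
      (S n).1 w = (S w.length).1 w ∧ (S n).2 w = (S w.length).2 w := by
    intro n w hw
    induction n, hw using Nat.le_induction with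
    | base => exact ⟨rfl, rfl⟩
    | succ n hn ih =>
      have := (hnext n _ (hS n)).2 w hn
      exact ⟨this.1.trans ih.1, this.2.trans ih.2⟩
  -- Diagonal limit: the value at `w` is frozen from stage `w.length` on.
  refine ⟨fun w => (S w.length).1 w,
    mem_shuffleGroup_of_stable (K := fun n => (S n).1) (fun n => (hS n).1)
      fun n w hw => (hst n w hw).1,
    fun w => (S w.length).2 w,
    mem_shuffleGroup_of_stable (K := fun n => (S n).2) (fun n => (hS n).2.1)
      fun n w hw => (hst n w hw).2, ?_, fun w hw => (hS w.length).2.2.2 w le_rfl hw⟩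
  funext w
  have h1 := congrFun (hS w.length).2.2.1 w
  rw [conv_congr (fun s hs => (hst w.length s hs).2) (fun s hs => ?_),
    conv_congr (β := η) (fun s hs => (hst w.length s hs).1) (fun s _ => rfl)] at h1
  · exact h1
  · rw [Xi, (hst w.length s hs).1]
    rfl

end NormalForm

/-! ### Unshuffles

`unshuffleSum k w X` is the sum of `X` over all ways to distribute the letters of the word `w`
among `k` subwords. -/

section Unshuffle

variable {A M N : Type*} [AddCommMonoid M] [AddCommMonoid N]

/-- The sum of `X` over all distributions of the letters of a word among `k` subwords. -/
def unshuffleSum (k : ℕ) : List A → ((Fin k → List A) → M) → M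
  | [], X => X fun _ => []
  | a :: w, X => ∑ i, unshuffleSum k w fun t => X (Function.update t i (a :: t i))

/-- The sum of `X` over all distributions of the letters of a word among two subwords. -/
def unshufflePairSum : List A → (List A → List A → M) → M
  | [], X => X [] []
  | a :: w, X => (unshufflePairSum w fun u u' => X (a :: u) u') +
      unshufflePairSum w fun u u' => X u (a :: u')

theorem unshufflePairSum_sum {ι : Type*} (s : Finset ι) (w : List A)
    (X : ι → List A → List A → M) :
    (unshufflePairSum w fun u u' => ∑ i ∈ s, X i u u') = ∑ i ∈ s, unshufflePairSum w (X i) := by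
  induction w generalizing X with
  | nil => rfl
  | cons a w ih => simp only [unshufflePairSum, ih, Finset.sum_add_distrib]

theorem unshuffleSum_sum {ι : Type*} (s : Finset ι) (k : ℕ) (w : List A)
    (X : ι → (Fin k → List A) → M) :
    (unshuffleSum k w fun t => ∑ i ∈ s, X i t) = ∑ i ∈ s, unshuffleSum k w (X i) := by
  induction w generalizing X with
  | nil => rfl
  | cons a w ih =>
    simp only [unshuffleSum, ih]
    exact Finset.sum_comm

theorem unshuffleSum_add (k : ℕ) (w : List A) (X Y : (Fin k → List A) → M) :
    (unshuffleSum k w fun t => X t + Y t) = unshuffleSum k w X + unshuffleSum k w Y := by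
  induction w generalizing X Y with
  | nil => rfl
  | cons a w ih => simp only [unshuffleSum, ih, Finset.sum_add_distrib]

theorem map_unshuffleSum {F : Type*} [FunLike F M N] [AddMonoidHomClass F M N] (g : F) (k : ℕ)
    (w : List A) (X : (Fin k → List A) → M) :
    g (unshuffleSum k w X) = unshuffleSum k w fun t => g (X t) := by
  induction w generalizing X with
  | nil => rfl
  | cons a w ih => simp only [unshuffleSum, map_sum, ih]

theorem sum_coe_update_cons {k : ℕ} (t : Fin k → List A) (i : Fin k) (a : A) :
    ∑ j, (Function.update t i (a :: t i) j : Multiset A) = a ::ₘ ∑ j, (t j : Multiset A) := by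
  have : ∀ j, (Function.update t i (a :: t i) j : Multiset A) =
      (if j = i then {a} else 0) + (t j : Multiset A) := by
    intro j
    rcases eq_or_ne j i with rfl | h
    · simp
    · simp [h]
  simp only [this, Finset.sum_add_distrib, Finset.sum_ite_eq', Finset.mem_univ, if_true,
    Multiset.singleton_add]

theorem unshuffleSum_congr {k : ℕ} {w : List A} {X Y : (Fin k → List A) → M}
    (h : ∀ t, ∑ i, (t i : Multiset A) = w → X t = Y t) :
    unshuffleSum k w X = unshuffleSum k w Y := by
  induction w generalizing X Y with
  | nil => exact h _ (by simp)
  | cons a w ih =>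
    simp only [unshuffleSum]
    refine Finset.sum_congr rfl fun i _ => ih fun t ht => h _ ?_
    rw [sum_coe_update_cons, ht, Multiset.cons_coe]

theorem unshuffleSum_zero (k : ℕ) (w : List A) :
    (unshuffleSum k w fun _ => (0 : M)) = 0 := by
  simpa using unshuffleSum_sum (∅ : Finset ℕ) k w fun _ _ => (0 : M)

/-- Pigeonhole: fewer letters than subwords leave some subword empty. -/
theorem unshuffleSum_eq_zero_of_lt {k : ℕ} {w : List A} (hk : w.length < k)
    {X : (Fin k → List A) → M} (h : ∀ t, (∃ i, t i = []) → X t = 0) : unshuffleSum k w X = 0 := by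
  rw [unshuffleSum_congr (Y := fun _ => 0), unshuffleSum_zero]
  intro t ht
  apply h
  by_contra! hne
  have h1 := congrArg Multiset.card ht
  rw [← Multiset.cardHom_apply, map_sum] at h1
  simp only [Multiset.cardHom_apply, Multiset.coe_card] at h1
  have h2 : ∑ _i : Fin k, 1 ≤ ∑ i, (t i).length :=
    Finset.sum_le_sum fun i _ => List.length_pos_iff.2 (hne i)
  simp at h2
  omega

/-- Separating the first subword. -/
theorem unshuffleSum_succ (k : ℕ) (w : List A) (X : (Fin (k + 1) → List A) → M) :
    unshuffleSum (k + 1) w X =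
      unshufflePairSum w fun u u' => unshuffleSum k u' fun t => X (Fin.cons u t) := by
  induction w generalizing X with
  | nil =>
    simp only [unshuffleSum, unshufflePairSum]
    congr 1
    funext i
    refine Fin.cases rfl (fun j => rfl) i
  | cons a w ih =>
    simp only [unshuffleSum, unshufflePairSum, Fin.sum_univ_succ, ih]
    congr 1
    · simp only [Fin.update_cons_zero, Fin.cons_zero]
    · rw [unshufflePairSum_sum]
      simp only [Fin.cons_succ, ← Fin.cons_update]

/-- Distributions with an empty `i`-th subword. -/
theorem unshuffleSum_ite_eq_nil [DecidableEq A] (k : ℕ) (w : List A) (i : Fin (k + 1))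
    (X : (Fin (k + 1) → List A) → M) :
    (unshuffleSum (k + 1) w fun t => if t i = [] then X t else 0) =
      unshuffleSum k w fun t => X (i.insertNth [] t) := by
  induction w generalizing X with
  | nil =>
    simp only [unshuffleSum, if_true]
    congr 1
    funext j
    refine Fin.succAboveCases i ?_ (fun j => ?_) j <;> simp
  | cons a w ih =>
    simp only [unshuffleSum]
    rw [Fin.sum_univ_succAbove _ i]
    simp only [Function.update_self, reduceCtorEq, if_false, unshuffleSum_zero, zero_add]
    refine Finset.sum_congr rfl fun j _ => ?_
    simp only [Function.update_of_ne (Fin.succAbove_ne i j).symm]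
    rw [ih]
    simp only [Fin.insertNth_apply_succAbove, Fin.insertNth_update]

/-! ### Shuffles of several words and their duality with unshuffles. -/

/-- The linear extension of `α`, evaluated at the shuffle product of the words `t 0, …, t (k-1)`. -/
def multiShuffleSum : (k : ℕ) → (Fin k → List A) → (List A → ℂ) → ℂ
  | 0, _, α => α []
  | k + 1, t, α => multiShuffleSum k (Fin.tail t) fun s => shuffleSum α (t 0) s

theorem multiShuffleSum_add (k : ℕ) (t : Fin k → List A) (α β : List A → ℂ) :
    (multiShuffleSum k t fun s => α s + β s) = multiShuffleSum k t α + multiShuffleSum k t β := by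
  induction k generalizing α β with
  | zero => rfl
  | succ k ih => simp only [multiShuffleSum, shuffleSum_add, ih]

theorem multiShuffleSum_mul_left (k : ℕ) (t : Fin k → List A) (c : ℂ) (α : List A → ℂ) :
    (multiShuffleSum k t fun s => c * α s) = c * multiShuffleSum k t α := by
  induction k generalizing α with
  | zero => rfl
  | succ k ih => simp only [multiShuffleSum, shuffleSum_mul_left, ih]

theorem multiShuffleSum_sum {ι : Type*} (s : Finset ι) (k : ℕ) (t : Fin k → List A)
    (α : ι → List A → ℂ) :
    (multiShuffleSum k t fun w => ∑ i ∈ s, α i w) = ∑ i ∈ s, multiShuffleSum k t (α i) := by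
  classical
  induction s using Finset.induction_on with
  | empty => simpa using multiShuffleSum_mul_left k t 0 fun _ => 0
  | insert i s hi ih => simp only [Finset.sum_insert hi, multiShuffleSum_add, ih]

theorem multiShuffleSum_congr {k : ℕ} {t : Fin k → List A} {α β : List A → ℂ}
    (h : ∀ s : List A, (s : Multiset A) = ∑ i, (t i : Multiset A) → α s = β s) :
    multiShuffleSum k t α = multiShuffleSum k t β := by
  induction k generalizing α β with
  | zero => exact h [] (by simp)
  | succ k ih =>
    refine ih fun s hs => shuffleSum_congr fun s' hs' => h s' ?_
    rw [Fin.sum_univ_succ, Multiset.coe_eq_coe.2 hs', ← Multiset.coe_add, hs]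
    rfl

theorem multiShuffleSum_of_mem {γ : List A → ℂ} (hγ : γ ∈ shuffleGroup A) (k : ℕ)
    (t : Fin k → List A) : multiShuffleSum k t γ = ∏ i, γ (t i) := by
  induction k with
  | zero => simpa [multiShuffleSum] using hγ.1
  | succ k ih =>
    simp only [multiShuffleSum, (mem_shuffleGroup.1 hγ).2, multiShuffleSum_mul_left, ih,
      Fin.prod_univ_succ]
    rfl

theorem unshufflePairSum_multiShuffleSum (k : ℕ) (t : Fin k → List A) (w : List A)
    (F : List A → List A → List A → ℂ) :
    (unshufflePairSum w fun u u' => multiShuffleSum k t (F u u')) =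
      multiShuffleSum k t fun s => unshufflePairSum w fun u u' => F u u' s := by
  induction w generalizing F with
  | nil => rfl
  | cons a w ih => simp only [unshufflePairSum, multiShuffleSum_add, ih]

theorem unshufflePairSum_ite_zero (w : List A) (p : Prop) [Decidable p] (X : List A → List A → ℂ) :
    (unshufflePairSum w fun u u' => if p then X u u' else 0) =
      if p then unshufflePairSum w X else 0 := by
  split_ifs
  · rfl
  · simpa using unshufflePairSum_sum (∅ : Finset ℕ) w fun _ _ _ => (0 : ℂ)

variable [DecidableEq A]

theorem shuffleSum_ite_cons (a b : A) (w u u' : List A) :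
    shuffleSum (fun s => if b :: s = a :: w then 1 else 0) u u' =
      if b = a then shuffleSum (fun s => if s = w then 1 else 0) u u' else 0 := by
  split_ifs with h
  · simp [h]
  · simp [h, shuffleSum]

/-- Shuffles and unshuffles are dual to each other: two words. -/
theorem unshufflePairSum_ite (w u u' : List A) :
    (unshufflePairSum w fun s s' => if s = u ∧ s' = u' then (1 : ℂ) else 0) =
      shuffleSum (fun s => if s = w then 1 else 0) u u' := by
  induction w generalizing u u' with
  | nil =>
    cases u with
    | nil => cases u' <;> simp [unshufflePairSum]
    | cons b u =>
      cases u' with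
      | nil => simp [unshufflePairSum]
      | cons c u' =>
        rw [shuffleSum_cons_cons]
        simp [unshufflePairSum, shuffleSum]
  | cons a w ih =>
    simp only [unshufflePairSum]
    have h1 : ∀ s s' : List A, (if a :: s = u ∧ s' = u' then (1 : ℂ) else 0) =
        if u.head? = some a then (if s = u.tail ∧ s' = u' then 1 else 0) else 0 := by
      intro s s'
      cases u with
      | nil => simp
      | cons b u => by_cases hb : a = b <;> simp [hb, eq_comm]
    have h2 : ∀ s s' : List A, (if s = u ∧ a :: s' = u' then (1 : ℂ) else 0) =
        if u'.head? = some a then (if s = u ∧ s' = u'.tail then 1 else 0) else 0 := by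
      intro s s'
      cases u' with
      | nil => simp
      | cons b u' => by_cases hb : a = b <;> simp [hb, eq_comm]
    simp only [h1, h2, unshufflePairSum_ite_zero, ih]
    cases u with
    | nil =>
      cases u' with
      | nil => simp
      | cons c u' => by_cases hc : c = a <;> simp [hc]
    | cons b u =>
      cases u' with
      | nil => by_cases hb : b = a <;> simp [hb]
      | cons c u' =>
        rw [shuffleSum_cons_cons, shuffleSum_ite_cons, shuffleSum_ite_cons]
        simp

/-- Shuffles and unshuffles are dual to each other. -/
theorem unshuffleSum_ite (k : ℕ) (w : List A) (t : Fin k → List A) :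
    (unshuffleSum k w fun s => if s = t then (1 : ℂ) else 0) =
      multiShuffleSum k t fun s => if s = w then 1 else 0 := by
  induction k generalizing w with
  | zero => cases w <;> simp [unshuffleSum, multiShuffleSum, Subsingleton.elim _ t]
  | succ k ih =>
    have h1 : ∀ u : List A, ∀ s : Fin k → List A,
        (if (Fin.cons u s : Fin (k + 1) → List A) = t then (1 : ℂ) else 0) =
          (if u = t 0 then (1 : ℂ) else 0) * (if s = Fin.tail t then 1 else 0) := by
      intro u s
      rw [ite_mul, one_mul, zero_mul, ← ite_and]
      refine if_congr ?_ rfl rfl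
      conv_lhs => rw [← Fin.cons_self_tail t]
      exact Fin.cons_inj
    rw [unshuffleSum_succ]
    simp only [h1]
    have h2 : ∀ u u' : List A, (unshuffleSum k u' fun s => (if u = t 0 then (1 : ℂ) else 0) *
        (if s = Fin.tail t then 1 else 0)) = multiShuffleSum k (Fin.tail t) fun s =>
          if u = t 0 ∧ u' = s then 1 else 0 := by
      intro u u'
      have := map_unshuffleSum (AddMonoidHom.mulLeft (if u = t 0 then (1 : ℂ) else 0)) k u'
        fun s => if s = Fin.tail t then 1 else 0
      simp only [AddMonoidHom.coe_mulLeft] at this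
      rw [← this, ih, ← multiShuffleSum_mul_left]
      congr 1
      funext s
      rw [ite_mul, one_mul, zero_mul, ← ite_and]
      simp only [eq_comm (a := s)]
    simp only [h2, unshufflePairSum_multiShuffleSum, unshufflePairSum_ite]
    rfl

/-! ### Words contributing to a given monomial. -/

/-- The words in which each letter `ℓ` occurs `m ℓ` times. -/
def wordsOf (m : A →₀ ℕ) : Finset (List A) := (Finsupp.toMultiset m).lists.toFinset

theorem mem_wordsOf {m : A →₀ ℕ} {w : List A} :
    w ∈ wordsOf m ↔ (w : Multiset A) = Finsupp.toMultiset m := by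
  simp [wordsOf, eq_comm]

theorem mem_wordsOf_iff_toFinsupp {m : A →₀ ℕ} {w : List A} :
    w ∈ wordsOf m ↔ Multiset.toFinsupp (w : Multiset A) = m := by
  rw [mem_wordsOf, ← Multiset.toFinsupp_eq_iff]

theorem wordsOf_zero : wordsOf (0 : A →₀ ℕ) = {[]} := by
  ext w
  simp [mem_wordsOf]

theorem length_of_mem_wordsOf {m : A →₀ ℕ} {w : List A} (h : w ∈ wordsOf m) :
    w.length = m.degree := by
  rw [mem_wordsOf] at h
  rw [← Multiset.coe_card, h, Finsupp.card_toMultiset]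
  rfl

/-- The inner `multiShuffleSum` is the multiplicity of `w` in the shuffle of the words `t i`, so the
sum evaluates `γ` on that shuffle. -/
theorem sum_multiShuffleSum_ite {γ : List A → ℂ} (hγ : γ ∈ shuffleGroup A) {k : ℕ}
    {t : Fin k → List A} {q : A →₀ ℕ} (ht : ∑ i, (t i : Multiset A) = Finsupp.toMultiset q) :
    ∑ w ∈ wordsOf q, γ w * multiShuffleSum k t (fun s => if s = w then 1 else 0) =
      ∏ i, γ (t i) := by
  rw [← multiShuffleSum_of_mem hγ]
  simp only [← multiShuffleSum_mul_left]
  rw [← multiShuffleSum_sum]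
  refine multiShuffleSum_congr fun s hs => ?_
  have : s ∈ wordsOf q := mem_wordsOf.2 (hs.trans ht)
  simp [this]

/-- This linearizes the products of coefficients in a Taylor expansion: the shuffle relations
replace each product by a sum over `w`, and duality reads the multiplicity of `w` as the number of
ways to unshuffle `w` into `t`. -/
theorem sum_piFinset_wordsOf {V : Type*} [AddCommGroup V] [Module ℂ V] {γ : List A → ℂ}
    (hγ : γ ∈ shuffleGroup A) (k : ℕ) (q : A →₀ ℕ) (X : (Fin k → List A) → V) :
    ∑ r ∈ Finset.piAntidiag (Finset.univ : Finset (Fin k)) q,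
      ∑ t ∈ Fintype.piFinset fun i => wordsOf (r i), (∏ i, γ (t i)) • X t =
    ∑ w ∈ wordsOf q, γ w • unshuffleSum k w X := by
  have hmem : ∀ (r : Fin k → A →₀ ℕ) (t : Fin k → List A),
      t ∈ (Fintype.piFinset fun i => wordsOf (r i)) ↔
        (fun i => Multiset.toFinsupp (t i : Multiset A)) = r := by
    intro r t
    simp only [Fintype.mem_piFinset, mem_wordsOf_iff_toFinsupp, funext_iff]
  have hsum : ∀ t : Fin k → List A, (fun i => Multiset.toFinsupp (t i : Multiset A)) ∈
      Finset.piAntidiag (Finset.univ : Finset (Fin k)) q ↔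
      ∑ i, (t i : Multiset A) = Finsupp.toMultiset q := by
    intro t
    rw [Finset.mem_piAntidiag, ← Multiset.toFinsupp_eq_iff, map_sum]
    simp
  have h1 : ∀ r ∈ Finset.piAntidiag (Finset.univ : Finset (Fin k)) q,
      ∀ t ∈ Fintype.piFinset fun i => wordsOf (r i), (∏ i, γ (t i)) • X t =
        ∑ w ∈ wordsOf q, γ w • unshuffleSum k w fun s => if s = t then X t else 0 := by
    intro r hr t ht
    rw [← (hmem r t).1 ht] at hr
    rw [← sum_multiShuffleSum_ite hγ ((hsum t).1 hr), Finset.sum_smul]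
    refine Finset.sum_congr rfl fun w _ => ?_
    rw [← unshuffleSum_ite, mul_smul]
    congr 1
    have := map_unshuffleSum ((LinearMap.toSpanSingleton ℂ V (X t)))
      k w fun s => if s = t then 1 else 0
    simp only [LinearMap.toSpanSingleton_apply, ite_smul, one_smul, zero_smul] at this
    exact this
  rw [Finset.sum_congr rfl fun r hr => Finset.sum_congr rfl fun t ht => h1 r hr t ht]
  simp only [Finset.sum_comm (t := wordsOf q), ← Finset.smul_sum]
  refine Finset.sum_congr rfl fun w hw => ?_
  congr 1
  simp only [← unshuffleSum_sum]
  refine unshuffleSum_congr fun t ht => ?_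
  rw [mem_wordsOf] at hw
  have h2 := (hsum t).2 (ht.trans hw)
  -- Each distribution `t` belongs to exactly one tuple `r` of multidegrees.
  simp only [Finset.sum_ite_eq, hmem, h2, if_true]

end Unshuffle

/-! ### Differential operators indexed by words -/

section WordOp

variable {A E : Type*} [NormedAddCommGroup E] [NormedSpace ℂ E]

/-- The differential operator `E_{ℓ₁} ⋯ E_{ℓₙ}`, where `(E_ℓ h)(x) = h'(x) f_ℓ(x)`. -/
def wordOp (f : A → E → E) : List A → (E → E) → E → E
  | [], h => h
  | ℓ :: w, h => fun x => fderiv ℂ (wordOp f w h) x (f ℓ x)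

theorem wordBasis_eq_wordOp (f : A → E → E) (w : List A) : wordBasis f w = wordOp f w id := by
  induction w with
  | nil => rfl
  | cons ℓ w ih => simp only [wordBasis, wordOp, ih]

theorem wordOp_append (f : A → E → E) (u w : List A) (h : E → E) :
    wordOp f (u ++ w) h = wordOp f u (wordOp f w h) := by
  induction u with
  | nil => rfl
  | cons ℓ u ih => simp only [List.cons_append, wordOp, ih]

theorem contDiff_wordOp {f : A → E → E} (hf : ∀ ℓ, ContDiff ℂ ∞ (f ℓ)) (w : List A) {h : E → E}
    (hh : ContDiff ℂ ∞ h) : ContDiff ℂ ∞ (wordOp f w h) := by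
  induction w with
  | nil => exact hh
  | cons ℓ w ih => exact (ih.fderiv_right (m := ∞) (by simp)).clm_apply (hf ℓ)

theorem wordOp_sum {f : A → E → E} (hf : ∀ ℓ, ContDiff ℂ ∞ (f ℓ)) (w : List A) {ι : Type*}
    (s : Finset ι) (c : ι → ℂ) {h : ι → E → E} (hh : ∀ i, ContDiff ℂ ∞ (h i)) (x : E) :
    wordOp f w (fun y => ∑ i ∈ s, c i • h i y) x = ∑ i ∈ s, c i • wordOp f w (h i) x := by
  induction w generalizing x with
  | nil => rfl
  | cons ℓ w ih =>
    simp only [wordOp]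
    have hd : HasFDerivAt (fun y => ∑ i ∈ s, c i • wordOp f w (h i) y)
        (∑ i ∈ s, c i • fderiv ℂ (wordOp f w (h i)) x) x :=
      HasFDerivAt.fun_sum fun i _ =>
        ((contDiff_wordOp hf w (hh i)).differentiable (by simp) x).hasFDerivAt.const_smul (c i)
    rw [funext ih, hd.fderiv]
    simp

theorem infty_add_natCast_le (n : ℕ) : (∞ : WithTop ℕ∞) + n ≤ ∞ := by
  exact_mod_cast (le_top : (⊤ : ℕ∞) + n ≤ ⊤)

/-- Symmetry of the iterated derivatives: an argument may be moved to the front. -/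
theorem iteratedFDeriv_insertNth {h : E → E} (hh : ContDiff ℂ ∞ h) {k : ℕ} (i : Fin (k + 1))
    (e : E) (m : Fin k → E) (x : E) :
    iteratedFDeriv ℂ (k + 1) h x (i.insertNth e m) =
      iteratedFDeriv ℂ (k + 1) h x (Fin.cons e m) := by
  induction k generalizing x with
  | zero =>
    rw [Fin.fin_one_eq_zero i, Fin.insertNth_zero']
  | succ k ih =>
    refine Fin.cases ?_ (fun j => ?_) i
    · rw [Fin.insertNth_zero']
    · rw [← Fin.cons_self_tail m, Fin.insertNth_succ_cons]
      have hsmooth : ∀ n : ℕ, ContDiff ℂ ∞ (iteratedFDeriv ℂ n h) := fun n =>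
        hh.iteratedFDeriv_right (m := ∞) (infty_add_natCast_le n)
      have hsucc : ∀ n : ℕ, ∀ (a : E) (u : Fin n → E) (y : E),
          iteratedFDeriv ℂ (n + 1) h y (Fin.cons a u) =
            fderiv ℂ (fun z => iteratedFDeriv ℂ n h z u) y a := by
        intro n a u y
        rw [fderiv_continuousMultilinear_apply_const_apply ((hsmooth n).differentiable (by simp) y),
          iteratedFDeriv_succ_apply_left, Fin.cons_zero, Fin.tail_cons]
      set G : E → E := fun y => iteratedFDeriv ℂ k h y (Fin.tail m) with hG
      have hGs : ContDiff ℂ ∞ G :=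
        (ContinuousMultilinearMap.apply ℂ (fun _ : Fin k => E) E (Fin.tail m)).contDiff.comp
          (hsmooth k)
      have hsymm : IsSymmSndFDerivAt ℂ G x :=
        hGs.contDiffAt.isSymmSndFDerivAt (by simpa using ENat.LEInfty.out)
      have hG2 : ∀ a b : E, fderiv ℂ (fun z => fderiv ℂ G z b) x a = fderiv ℂ (fderiv ℂ G) x a b := by
        intro a b
        rw [fderiv_clm_apply
          ((hGs.fderiv_right (m := ∞) (by simp)).differentiable (by simp) x) (by simp)]
        simp
      have hswap : ∀ a b : E, iteratedFDeriv ℂ (k + 2) h x (Fin.cons a (Fin.cons b (Fin.tail m))) =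
          fderiv ℂ (fderiv ℂ G) x a b := by
        intro a b
        rw [hsucc, funext fun z => hsucc k b (Fin.tail m) z, hG2]
      -- Induction brings `e` to the second slot; symmetry of the second derivative of `G` exchanges
      -- the first two.
      rw [hsucc, funext fun z => ih j (Fin.tail m) z, ← hsucc, hswap, hswap]
      exact hsymm _ _

theorem fderiv_unshuffleSum {k : ℕ} (w : List A) {X : E → (Fin k → List A) → E} {x : E}
    (hX : ∀ t, DifferentiableAt ℂ (fun y => X y t) x) (e : E) :
    DifferentiableAt ℂ (fun y => unshuffleSum k w (X y)) x ∧
    fderiv ℂ (fun y => unshuffleSum k w (X y)) x e =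
      unshuffleSum k w fun t => fderiv ℂ (fun y => X y t) x e := by
  induction w generalizing X with
  | nil => exact ⟨hX _, rfl⟩
  | cons a w ih =>
    simp only [unshuffleSum]
    have h1 := fun i : Fin k => ih (X := fun y t => X y (Function.update t i (a :: t i)))
      fun t => hX _
    refine ⟨DifferentiableAt.fun_sum fun i _ => (h1 i).1, ?_⟩
    rw [fderiv_fun_sum fun i _ => (h1 i).1]
    simp only [sum_apply, (h1 _).2]

/-! ### The iterated chain rule. -/

/-- The term of the iterated chain rule in which the letters of a word are distributed among the
nonempty subwords `t 0, …, t (k-1)`. -/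
def chainTerm (f : A → E → E) (h φ : E → E) (k : ℕ) (x : E) (t : Fin k → List A) : E :=
  if ∀ i, t i ≠ [] then iteratedFDeriv ℂ k h (φ x) fun i => wordOp f (t i) φ x else 0

/-- The terms in which a new letter `ℓ` forms a subword of its own. -/
def chainTermNew (f : A → E → E) (h φ : E → E) (ℓ : A) (k : ℕ) (x : E) (t : Fin k → List A) : E :=
  if ∀ i, t i ≠ [] then
    iteratedFDeriv ℂ (k + 1) h (φ x) (Fin.cons (wordOp f [ℓ] φ x) fun i => wordOp f (t i) φ x)
  else 0

/-- The terms in which a new letter `ℓ` is attached to one of the subwords. -/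
def chainTermOld (f : A → E → E) (h φ : E → E) (ℓ : A) (k : ℕ) (x : E) (t : Fin k → List A) : E :=
  if ∀ i, t i ≠ [] then
    ∑ i, iteratedFDeriv ℂ k h (φ x) fun j => wordOp f (Function.update t i (ℓ :: t i) j) φ x
  else 0

variable {f : A → E → E} {h φ : E → E}

theorem fderiv_chainTerm (hf : ∀ ℓ, ContDiff ℂ ∞ (f ℓ)) (hh : ContDiff ℂ ∞ h)
    (hφ : ContDiff ℂ ∞ φ) (ℓ : A) (k : ℕ) (x : E) (t : Fin k → List A) :
    DifferentiableAt ℂ (fun y => chainTerm f h φ k y t) x ∧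
    fderiv ℂ (fun y => chainTerm f h φ k y t) x (f ℓ x) =
      chainTermNew f h φ ℓ k x t + chainTermOld f h φ ℓ k x t := by
  simp only [chainTerm, chainTermNew, chainTermOld]
  split_ifs with ht
  · have h1 : HasFDerivAt (fun y => iteratedFDeriv ℂ k h (φ y))
        ((fderiv ℂ (iteratedFDeriv ℂ k h) (φ x)).comp (fderiv ℂ φ x)) x :=
      (((hh.iteratedFDeriv_right (m := ∞) (infty_add_natCast_le k)).differentiable (by simp)
        (φ x)).hasFDerivAt).comp x (hφ.differentiable (by simp) x).hasFDerivAt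
    have h2 : ∀ i, HasFDerivAt (wordOp f (t i) φ) (fderiv ℂ (wordOp f (t i) φ) x) x := fun i =>
      ((contDiff_wordOp hf (t i) hφ).differentiable (by simp) x).hasFDerivAt
    have h3 := h1.continuousMultilinearMap_apply h2
    refine ⟨h3.differentiableAt, ?_⟩
    rw [h3.fderiv]
    simp only [add_apply, sum_apply, ContinuousLinearMap.comp_apply,
      ContinuousMultilinearMap.apply_apply]
    congr 1
    refine Finset.sum_congr rfl fun i _ => ?_
    rw [ContinuousMultilinearMap.toContinuousLinearMap_apply]
    congr 1
    funext j
    rcases eq_or_ne j i with rfl | hj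
    · simp [wordOp]
    · simp [hj]
  · simp

/-- Attaching a letter to the chain rule terms. -/
theorem chainTerm_update (ℓ : A) (k : ℕ) (x : E) (t : Fin k → List A) (i : Fin k) :
    chainTerm f h φ k x (Function.update t i (ℓ :: t i)) =
      (if ∀ j, t j ≠ [] then iteratedFDeriv ℂ k h (φ x)
        fun j => wordOp f (Function.update t i (ℓ :: t i) j) φ x else 0) +
      (if t i = [] then (if ∀ j, j ≠ i → t j ≠ [] then iteratedFDeriv ℂ k h (φ x)
        fun j => wordOp f (Function.update t i [ℓ] j) φ x else 0) else 0) := by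
  have h1 : (∀ j, Function.update t i (ℓ :: t i) j ≠ []) ↔ ∀ j, j ≠ i → t j ≠ [] := by
    refine forall_congr' fun j => ?_
    rcases eq_or_ne j i with rfl | hj
    · simp
    · simp [hj]
  rw [chainTerm, if_congr h1 rfl rfl]
  by_cases hi : t i = []
  · rw [if_neg (c := ∀ j, t j ≠ []) (fun hall => hall i hi), zero_add, if_pos hi]
    simp only [hi]
  · rw [if_neg hi, add_zero]
    refine if_congr ⟨fun hj j => ?_, fun hj j _ => hj j⟩ rfl rfl
    rcases eq_or_ne j i with rfl | hji
    · exact hi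
    · exact hj j hji

variable [DecidableEq A]

/-- The letter `ℓ` either joins a nonempty subword or stands alone in one of `k + 1` slots. By
symmetry of the derivative these slots contribute equally, and the factor `k + 1` turns `1/(k+1)!`
into `1/k!`. -/
theorem unshuffleSum_cons_chainTerm_succ (hh : ContDiff ℂ ∞ h) (ℓ : A) (w : List A) (k : ℕ)
    (x : E) :
    unshuffleSum (k + 1) (ℓ :: w) (chainTerm f h φ (k + 1) x) =
      unshuffleSum (k + 1) w (chainTermOld f h φ ℓ (k + 1) x) +
        (k + 1) • unshuffleSum k w (chainTermNew f h φ ℓ k x) := by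
  have hold : ∀ t, chainTermOld f h φ ℓ (k + 1) x t = ∑ i, if ∀ j, t j ≠ [] then
      iteratedFDeriv ℂ (k + 1) h (φ x)
        fun j => wordOp f (Function.update t i (ℓ :: t i) j) φ x else 0 := by
    intro t
    rw [chainTermOld]
    split_ifs <;> simp
  have hnew : ∀ i : Fin (k + 1), (unshuffleSum k w fun t =>
      if ∀ j, j ≠ i → (i.insertNth [] t : Fin (k + 1) → List A) j ≠ [] then
        iteratedFDeriv ℂ (k + 1) h (φ x) fun j =>
          wordOp f (Function.update (i.insertNth [] t : Fin (k + 1) → List A) i [ℓ] j) φ x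
      else 0) = unshuffleSum k w (chainTermNew f h φ ℓ k x) := by
    intro i
    refine unshuffleSum_congr fun t _ => ?_
    rw [chainTermNew, ← iteratedFDeriv_insertNth hh i]
    refine if_congr ⟨fun hj j => ?_, fun hj => Fin.succAboveCases i (fun hii => absurd rfl hii)
      fun j _ => ?_⟩ ?_ rfl
    · simpa using hj (i.succAbove j) (Fin.succAbove_ne i j)
    · congr 1
      funext j
      refine Fin.succAboveCases i ?_ (fun j => ?_) j <;> simp
    · simpa using hj j
  simp only [unshuffleSum, chainTerm_update, unshuffleSum_add, unshuffleSum_ite_eq_nil,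
    Finset.sum_add_distrib, hnew, Finset.sum_const, Finset.card_univ, Fintype.card_fin]
  rw [← unshuffleSum_sum, funext hold]

/-- The iterated chain rule (Faà di Bruno's formula) for the operators `wordOp`. -/
theorem wordOp_comp (hf : ∀ ℓ, ContDiff ℂ ∞ (f ℓ)) (hh : ContDiff ℂ ∞ h)
    (hφ : ContDiff ℂ ∞ φ) (w : List A) {n : ℕ} (hn : w.length ≤ n) (x : E) :
    wordOp f w (fun y => h (φ y)) x =
      ∑ k ∈ Finset.range (n + 1),
        (k.factorial : ℂ)⁻¹ • unshuffleSum k w (chainTerm f h φ k x) := by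
  induction w generalizing x with
  | nil =>
    rw [Finset.sum_range_succ', Finset.sum_eq_zero]
    · simp [unshuffleSum, chainTerm, wordOp]
    · intro k _
      simp [unshuffleSum, chainTerm]
  | cons ℓ w ih =>
    rw [List.length_cons] at hn
    simp only [wordOp]
    rw [funext fun y => ih (by omega) y]
    have hd := fun k => fderiv_unshuffleSum w (x := x) (X := chainTerm f h φ k)
      (fun t => (fderiv_chainTerm hf hh hφ ℓ k x t).1) (f ℓ x)
    rw [fderiv_fun_sum fun k _ => (hd k).1.fun_const_smul _]
    simp only [sum_apply, fderiv_fun_const_smul (hd _).1, smul_apply, (hd _).2,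
      (fderiv_chainTerm hf hh hφ ℓ _ x _).2, unshuffleSum_add, smul_add, Finset.sum_add_distrib]
    -- The new-letter term with `k = n` vanishes, as `w` has fewer than `n` letters; the other
    -- new-letter terms match index `k + 1` on the right.
    rw [Finset.sum_range_succ (fun k => (k.factorial : ℂ)⁻¹ •
        unshuffleSum k w (chainTermNew f h φ ℓ k x)),
      unshuffleSum_eq_zero_of_lt (by omega) (fun t ⟨i, hi⟩ => if_neg fun hall => hall i hi),
      Finset.sum_range_succ' _ n, Finset.sum_range_succ' _ n]
    simp only [unshuffleSum_cons_chainTerm_succ hh, smul_add, Finset.sum_add_distrib]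
    have h0 : unshuffleSum 0 w (chainTermOld f h φ ℓ 0 x) = 0 := by
      refine (unshuffleSum_congr fun t _ => ?_).trans (unshuffleSum_zero 0 w)
      simp [chainTermOld]
    have h1 : unshuffleSum 0 (ℓ :: w) (chainTerm f h φ 0 x) = 0 := by simp [unshuffleSum]
    rw [h0, h1]
    simp only [smul_zero, add_zero]
    rw [add_comm]
    congr 1
    refine Finset.sum_congr rfl fun k _ => ?_
    rw [← Nat.cast_smul_eq_nsmul ℂ, smul_smul, Nat.factorial_succ]
    congr 1
    have : ((k + 1 : ℕ) : ℂ) ≠ 0 := Nat.cast_ne_zero.2 k.succ_ne_zero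
    push_cast at this ⊢
    field_simp

/-! ### Substitution in word series -/

/-- The series `φ(W_γ(x))` for a character `γ`, in the form `∑_w γ_w (E_w φ)(x)`. -/
def opSeries (f : A → E → E) (γ : List A → ℂ) (φ : E → E) : FormalMap A E :=
  fun m x => ∑ w ∈ wordsOf m, γ w • wordOp f w φ x

theorem wordSeries_eq_opSeries (f : A → E → E) (γ : List A → ℂ) :
    wordSeries f γ = opSeries f γ id := by
  funext m x
  simp only [wordSeries, opSeries, wordBasis_eq_wordOp, wordsOf]

/-- Multilinear expansion of the Taylor terms, linearized by `sum_piFinset_wordsOf`, gives exactly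
the chain rule terms of `wordOp f w (h ∘ φ)`. The condition `r i ≠ 0` corresponds to nonempty
subwords. -/
theorem substCoeff_opSeries (hf : ∀ ℓ, ContDiff ℂ ∞ (f ℓ)) (hh : ContDiff ℂ ∞ h)
    (hφ : ContDiff ℂ ∞ φ) {γ : List A → ℂ} (hγ : γ ∈ shuffleGroup A) (q : A →₀ ℕ) (x : E) :
    FormalMap.substCoeff h (opSeries f γ φ) q x = opSeries f γ (fun y => h (φ y)) q x := by
  have h0 : opSeries f γ φ 0 x = φ x := by simp [opSeries, wordsOf_zero, hγ.1, wordOp]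
  have hk : ∀ k : ℕ,
      ∑ r ∈ (Finset.piAntidiag (Finset.univ : Finset (Fin k)) q).filter (fun r => ∀ i, r i ≠ 0),
        iteratedFDeriv ℂ k h (φ x) (fun i => opSeries f γ φ (r i) x) =
      ∑ w ∈ wordsOf q, γ w • unshuffleSum k w (chainTerm f h φ k x) := by
    intro k
    rw [← sum_piFinset_wordsOf hγ, Finset.sum_filter]
    refine Finset.sum_congr rfl fun r _ => ?_
    split_ifs with hr
    · simp only [opSeries]
      rw [ContinuousMultilinearMap.map_sum_finset]
      refine Finset.sum_congr rfl fun t ht => ?_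
      rw [ContinuousMultilinearMap.map_smul_univ, chainTerm, if_pos]
      intro i hi
      have := Fintype.mem_piFinset.1 ht i
      rw [hi, mem_wordsOf_iff_toFinsupp] at this
      exact hr i (by simpa using this.symm)
    · refine (Finset.sum_eq_zero fun t ht => ?_).symm
      push Not at hr
      obtain ⟨i, hi⟩ := hr
      have := Fintype.mem_piFinset.1 ht i
      rw [hi, wordsOf_zero, Finset.mem_singleton] at this
      rw [chainTerm, if_neg (fun hall => hall i this), smul_zero]
  simp only [FormalMap.substCoeff, h0, hk, Finset.smul_sum]
  rw [Finset.sum_comm, opSeries]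
  refine Finset.sum_congr rfl fun w hw => ?_
  rw [wordOp_comp hf hh hφ w (length_of_mem_wordsOf hw).le, Finset.smul_sum]
  exact Finset.sum_congr rfl fun k _ => smul_comm _ _ _

end WordOp

/-! ### Flows and eigenvector fields -/

section Flow

variable {E : Type*} [NormedAddCommGroup E] [NormedSpace ℂ E]

/-- The mean value inequality is used twice: for `G'` near `p`, then for `G` minus its linear part.
-/
theorem norm_sub_sub_fderiv_le {G : E → E} (hG : ContDiff ℂ ∞ G) {S : Set E}
    (hS : Convex ℝ S) {K : ℝ} (hK : ∀ y ∈ S, ‖fderiv ℂ (fderiv ℂ G) y‖ ≤ K) {p q : E}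
    (hp : p ∈ S) (hq : q ∈ S) : ‖G q - G p - fderiv ℂ G p (q - p)‖ ≤ K * ‖q - p‖ ^ 2 := by
  have hK0 : 0 ≤ K := (norm_nonneg _).trans (hK p hp)
  have hG' : Differentiable ℂ (fderiv ℂ G) :=
    (hG.fderiv_right (m := ∞) (by simp)).differentiable (by simp)
  have h1 : ∀ y ∈ S ∩ Metric.closedBall p ‖q - p‖, ‖fderiv ℂ G y - fderiv ℂ G p‖ ≤
      K * ‖q - p‖ := by
    rintro y ⟨hy, hyp⟩
    refine (hS.norm_image_sub_le_of_norm_fderiv_le (𝕜 := ℂ) (fun z _ => hG' z) hK hp hy).trans ?_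
    rw [mem_closedBall_iff_norm] at hyp
    gcongr
  have h2 := (hS.inter (convex_closedBall p ‖q - p‖)).norm_image_sub_le_of_norm_fderiv_le' (𝕜 := ℂ)
    (fun z _ => hG.differentiable (by simp) z) h1 (x := p) (y := q)
    ⟨hp, by simp⟩ ⟨hq, mem_closedBall_iff_norm.2 le_rfl⟩
  rw [sq, ← mul_assoc]
  exact h2

/-- Solutions of the variational equation give the derivative of the flow with respect to the
initial value. -/
theorem fderiv_flow_apply [ProperSpace E] {G : E → E} (hG : ContDiff ℂ ∞ G) {Φ : ℝ → E → E}
    (hΦ : ∀ t x, HasDerivAt (fun t => Φ t x) (G (Φ t x)) t) (hΦ0 : ∀ x, Φ 0 x = x) {x : E}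
    {m : ℝ → E} (hm : ∀ t, HasDerivAt m (fderiv ℂ G (Φ t x) (m t)) t)
    (hd : DifferentiableAt ℂ (Φ 1) x) : fderiv ℂ (Φ 1) x (m 0) = m 1 := by
  obtain ⟨R, hR⟩ := (isCompact_Icc (a := (0 : ℝ)) (b := 1)).exists_bound_of_continuousOn
    (f := fun t => Φ t x) fun t _ => (hΦ t x).continuousAt.continuousWithinAt
  obtain ⟨M, hM⟩ := (isCompact_Icc (a := (0 : ℝ)) (b := 1)).exists_bound_of_continuousOn
    (f := m) fun t _ => (hm t).continuousAt.continuousWithinAt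
  have hM0 : 0 ≤ M := (norm_nonneg _).trans (hM 0 (by simp))
  -- The margin 2 leaves 1 for the displacement `s • m t` and 1 for the error of the linearization.
  set S : Set E := Metric.closedBall 0 (R + 2) with hSdef
  have hS : Convex ℝ S := convex_closedBall _ _
  have hG1 : ContDiff ℂ ∞ (fderiv ℂ G) := hG.fderiv_right (m := ∞) (by simp)
  have hG2 : ContDiff ℂ ∞ (fderiv ℂ (fderiv ℂ G)) := hG1.fderiv_right (m := ∞) (by simp)
  obtain ⟨K, hK⟩ := (isCompact_closedBall (0 : E) (R + 2)).exists_bound_of_continuousOn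
    hG1.continuous.continuousOn
  obtain ⟨K₂, hK₂⟩ := (isCompact_closedBall (0 : E) (R + 2)).exists_bound_of_continuousOn
    hG2.continuous.continuousOn
  have hxS : Φ 0 x ∈ S := by
    rw [hSdef, mem_closedBall_zero_iff]
    linarith [hR 0 (by simp)]
  have hK0 : 0 ≤ K := (norm_nonneg _).trans (hK _ hxS)
  have hK₂0 : 0 ≤ K₂ := (norm_nonneg _).trans (hK₂ _ hxS)
  set C := K₂ * M ^ 2 + 1 with hC
  have hC0 : 0 < C := by positivity
  -- A Grönwall estimate: the linearization error stays below the barrier `s² C exp((K + 1) t)`. On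
  -- contact its derivative is at most `K b + K₂ (s M)²`, and the `+ 1` in `C` and in `K + 1` makes
  -- this strictly less than `(K + 1) b`.
  have key : ∀ s : ℝ, 0 < s → s * M ≤ 1 → s ^ 2 * C * Real.exp (K + 1) ≤ 1 →
      ‖Φ 1 (x + s • m 0) - Φ 1 x - s • m 1‖ ≤ s ^ 2 * C * Real.exp (K + 1) := by
    intro s hs hsM hsC
    have hfence := image_norm_le_of_norm_deriv_right_lt_deriv_boundary
      (f := fun t => Φ t (x + s • m 0) - Φ t x - s • m t)
      (f' := fun t => G (Φ t (x + s • m 0)) - G (Φ t x) - s • fderiv ℂ G (Φ t x) (m t))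
      (a := 0) (b := 1) (B := fun t => s ^ 2 * C * Real.exp ((K + 1) * t))
      (B' := fun t => (K + 1) * (s ^ 2 * C * Real.exp ((K + 1) * t)))
      (fun t _ => (((hΦ t _).sub (hΦ t x)).sub
        ((hm t).const_smul s)).continuousAt.continuousWithinAt)
      (fun t _ => (((hΦ t _).sub (hΦ t x)).sub ((hm t).const_smul s)).hasDerivWithinAt)
      (by
        simp only [hΦ0, add_sub_cancel_left, sub_self, norm_zero]
        positivity)
      (fun t => by
        have h1 : HasDerivAt (fun t : ℝ => (K + 1) * t) (K + 1) t := by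
          simpa using (hasDerivAt_id t).const_mul (K + 1)
        exact (h1.exp.const_mul (s ^ 2 * C)).congr_deriv (by ring))
      (by
        intro t ht hB
        have htI : t ∈ Set.Icc (0 : ℝ) 1 := Set.Ico_subset_Icc_self ht
        have hBle : s ^ 2 * C * Real.exp ((K + 1) * t) ≤ 1 := by
          refine le_trans ?_ hsC
          gcongr
          nlinarith [ht.2]
        have hBge : s ^ 2 * C ≤ s ^ 2 * C * Real.exp ((K + 1) * t) := by
          refine le_mul_of_one_le_right (by positivity) (Real.one_le_exp ?_)
          have := ht.1
          positivity
        set b := s ^ 2 * C * Real.exp ((K + 1) * t) with hb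
        set p := Φ t x with hp
        set q := p + s • m t with hq
        set z := Φ t (x + s • m 0) with hz
        have hsm : ‖s • m t‖ ≤ s * M := by
          rw [norm_smul, Real.norm_of_nonneg hs.le]
          gcongr
          exact hM t htI
        have hpS : p ∈ S := by
          rw [hSdef, mem_closedBall_zero_iff]
          linarith [hR t htI]
        have hqn : ‖q‖ ≤ R + 1 := (norm_add_le _ _).trans (by linarith [hR t htI])
        have hqS : q ∈ S := by
          rw [hSdef, mem_closedBall_zero_iff]
          linarith
        have hzq : ‖z - q‖ = b := by
          rw [← hB, hq, sub_add_eq_sub_sub]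
        have hzS : z ∈ S := by
          rw [hSdef, mem_closedBall_zero_iff, ← sub_add_cancel z q]
          exact (norm_add_le _ _).trans (by linarith)
        have e1 : ‖G z - G q‖ ≤ K * b := by
          rw [← hzq]
          exact hS.norm_image_sub_le_of_norm_fderiv_le (𝕜 := ℂ)
            (fun y _ => hG.differentiable (by simp) y) hK hqS hzS
        have e2 : ‖G q - G p - fderiv ℂ G p (s • m t)‖ ≤ K₂ * (s * M) ^ 2 := by
          have := norm_sub_sub_fderiv_le hG hS hK₂ hpS hqS
          rw [hq, add_sub_cancel_left] at this
          refine this.trans ?_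
          gcongr
        have e3 : G z - G p - s • fderiv ℂ G p (m t) =
            (G z - G q) + (G q - G p - fderiv ℂ G p (s • m t)) := by
          rw [(fderiv ℂ G p).map_smul_of_tower s (m t)]
          abel
        rw [e3]
        refine (norm_add_le _ _).trans_lt ?_
        have e4 : K₂ * (s * M) ^ 2 < b := by
          have : 0 < s ^ 2 := by positivity
          nlinarith
        linarith)
    have := hfence (x := 1) (by simp)
    simpa using this
  have h1 : HasDerivAt (fun s : ℝ => Φ 1 (x + s • m 0)) (fderiv ℂ (Φ 1) x (m 0)) 0 := by
    have hline : HasDerivAt (fun s : ℝ => x + s • m 0) (m 0) 0 := by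
      simpa using ((hasDerivAt_id (0 : ℝ)).smul_const (m 0)).const_add x
    have hd' : HasFDerivAt (Φ 1) ((fderiv ℂ (Φ 1) x).restrictScalars ℝ) (x + (0 : ℝ) • m 0) := by
      simpa using hd.hasFDerivAt.restrictScalars ℝ
    exact hd'.comp_hasDerivAt 0 hline
  -- The quadratic estimate, available for `s > 0`, gives `m 1` as right derivative; it must equal
  -- the directional derivative.
  have h2 : HasDerivWithinAt (fun s : ℝ => Φ 1 (x + s • m 0)) (m 1) (Set.Ioi 0) 0 := by
    rw [hasDerivWithinAt_iff_isLittleO]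
    have hO : (fun s : ℝ => Φ 1 (x + s • m 0) - Φ 1 (x + (0 : ℝ) • m 0) - (s - 0) • m 1)
        =O[nhdsWithin 0 (Set.Ioi 0)] fun s : ℝ => s ^ 2 := by
      refine Asymptotics.IsBigO.of_bound (C * Real.exp (K + 1)) ?_
      have t1 : ∀ᶠ s : ℝ in nhdsWithin 0 (Set.Ioi 0), s * M < 1 :=
        nhdsWithin_le_nhds ((continuous_id.mul continuous_const).tendsto' (0 : ℝ) 0 (by simp)
          |>.eventually_lt_const one_pos)
      have t2 : ∀ᶠ s : ℝ in nhdsWithin 0 (Set.Ioi 0), s ^ 2 * C * Real.exp (K + 1) < 1 :=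
        nhdsWithin_le_nhds ((((continuous_id.pow 2).mul continuous_const).mul
          continuous_const).tendsto' (0 : ℝ) 0 (by simp) |>.eventually_lt_const one_pos)
      filter_upwards [t1, t2, self_mem_nhdsWithin] with s hs1 hs2 hs3
      have := key s hs3 hs1.le hs2.le
      simp only [zero_smul, add_zero, sub_zero, norm_pow, Real.norm_eq_abs, sq_abs]
      linarith
    refine hO.trans_isLittleO ?_
    simp only [sub_zero]
    have := (Asymptotics.isLittleO_pow_id (𝕜 := ℝ) one_lt_two).mono
      (nhdsWithin_le_nhds (s := Set.Ioi 0))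
    exact this
  exact (uniqueDiffWithinAt_Ioi 0).eq_deriv _ h1.hasDerivWithinAt h2

variable {A : Type*} {d : ℕ} {ν : Fin d → A → ℂ} {g : Fin d → E → E} {f : A → E → E}
  {φ : (Fin d → ℂ) → E → E}

theorem contDiff_linComb (hg : ∀ j, ContDiff ℂ ∞ (g j)) (v : Fin d → ℂ) :
    ContDiff ℂ ∞ (linComb g v) :=
  ContDiff.sum fun j _ => (hg j).const_smul (v j)

theorem IsPerturbedSystem.lieBracket_linComb (hs : IsPerturbedSystem ν g f) (v : Fin d → ℂ)
    (ℓ : A) (x : E) :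
    fderiv ℂ (f ℓ) x (linComb g v x) - fderiv ℂ (linComb g v) x (f ℓ x) =
      nuWord ν v [ℓ] • f ℓ x := by
  have h1 : HasFDerivAt (linComb g v) (∑ j, v j • fderiv ℂ (g j) x) x :=
    HasFDerivAt.fun_sum fun j _ =>
      ((hs.smooth_g j).differentiable (by simp) x).hasFDerivAt.const_smul (v j)
  have h2 : ∀ j, fderiv ℂ (f ℓ) x (g j x) - fderiv ℂ (g j) x (f ℓ x) = ν j ℓ • f ℓ x := fun j =>
    congrFun (hs.eigen j ℓ) x
  rw [h1.fderiv]
  simp only [linComb, map_sum, map_smul, sum_apply, smul_apply, ← Finset.sum_sub_distrib,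
    ← smul_sub, h2]
  simp [nuWord, Finset.sum_smul, mul_smul]

/-- The flow `φ_v` maps the field `f_ℓ` to a multiple of itself. -/
theorem IsPerturbedSystem.apply_flow [ProperSpace E] (hs : IsPerturbedSystem ν g f)
    (hφ : IsFlowFamily g φ) (v : Fin d → ℂ) (ℓ : A) (x : E) :
    f ℓ (φ v x) = Complex.exp (nuWord ν v [ℓ]) • fderiv ℂ (φ v) x (f ℓ x) := by
  set μ := nuWord ν v [ℓ] with hμ
  -- The bracket relation says that `f ℓ` along the orbit satisfies the variational equation up to
  -- the extra term `μ f ℓ`, which the exponential factor cancels.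
  have hm : ∀ t : ℝ, HasDerivAt (fun t : ℝ => Complex.exp (-(t * μ)) • f ℓ (φ ((t : ℂ) • v) x))
      (fderiv ℂ (linComb g v) (φ ((t : ℂ) • v) x)
        (Complex.exp (-(t * μ)) • f ℓ (φ ((t : ℂ) • v) x))) t := by
    intro t
    have h1 : HasDerivAt (fun t : ℝ => Complex.exp (-(t * μ))) (Complex.exp (-(t * μ)) * -μ) t := by
      have : HasDerivAt (fun z : ℂ => -(z * μ)) (-μ) (t : ℂ) := by
        simpa using ((hasDerivAt_id (t : ℂ)).mul_const μ).fun_neg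
      exact this.cexp.comp_ofReal
    have h2 : HasDerivAt (fun t : ℝ => f ℓ (φ ((t : ℂ) • v) x))
        (fderiv ℂ (f ℓ) (φ ((t : ℂ) • v) x) (linComb g v (φ ((t : ℂ) • v) x))) t :=
      (((hs.smooth_f ℓ).differentiable (by simp) _).hasFDerivAt.restrictScalars ℝ).comp_hasDerivAt
        t (hφ.integralCurve v x t)
    refine (h1.fun_smul h2).congr_deriv ?_
    have h3 := hs.lieBracket_linComb v ℓ (φ ((t : ℂ) • v) x)
    rw [sub_eq_iff_eq_add] at h3
    rw [h3, map_smul, ← hμ, smul_add, smul_smul, mul_neg, neg_smul]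
    abel
  have h1 := fderiv_flow_apply (contDiff_linComb hs.smooth_g v)
    (Φ := fun t => φ ((t : ℂ) • v)) (fun t x => hφ.integralCurve v x t)
    (fun x => by simpa using hφ.map_zero x) hm
    (by simpa using (hφ.smooth v).differentiable (by simp) x)
  simp only [Complex.ofReal_zero, zero_mul, neg_zero, Complex.exp_zero, one_smul, zero_smul,
    Complex.ofReal_one, one_mul, hφ.map_zero] at h1
  rw [h1, smul_smul, ← Complex.exp_add, add_neg_cancel, Complex.exp_zero, one_smul]

theorem IsPerturbedSystem.wordOp_apply_flow [ProperSpace E] (hs : IsPerturbedSystem ν g f)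
    (hφ : IsFlowFamily g φ) (v : Fin d → ℂ) {h : E → E} (hh : ContDiff ℂ ∞ h) (w : List A)
    (x : E) :
    wordOp f w h (φ v x) =
      Complex.exp (nuWord ν v w) • wordOp f w (fun y => h (φ v y)) x := by
  have hd : Differentiable ℂ (φ v) := (hφ.smooth v).differentiable (by simp)
  induction w generalizing x with
  | nil => simp [wordOp]
  | cons ℓ w ih =>
    have h1 := ((contDiff_wordOp hs.smooth_f w hh).differentiable (by simp) (φ v x)).hasFDerivAt.comp
      x (hd x).hasFDerivAt
    have h2 := ((contDiff_wordOp hs.smooth_f w (hh.comp (hφ.smooth v))).differentiable (by simp)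
      x).hasFDerivAt.const_smul (Complex.exp (nuWord ν v w))
    -- The induction hypothesis is an identity between functions of `x`, so both sides have the same
    -- derivative.
    have h3 := h1.unique (h2.congr_of_eventuallyEq (Filter.Eventually.of_forall ih))
    have h4 := DFunLike.congr_fun h3 (f ℓ x)
    simp only [wordOp]
    rw [hs.apply_flow hφ v ℓ x, map_smul, ← List.singleton_append (l := w), nuWord_append,
      Complex.exp_add, mul_smul]
    exact congrArg _ h4

end Flow

/-! ### Composition of word series -/

section Composition

variable {A E : Type*} [DecidableEq A] [NormedAddCommGroup E] [NormedSpace ℂ E]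

/-- A pair `(u, w)` is the same as the word `u ++ w` with a cut position. -/
theorem sum_wordsOf_conv (γ δ : List A → ℂ) (m : A →₀ ℕ) (X : List A → E) :
    ∑ p ∈ Finset.HasAntidiagonal.antidiagonal m, ∑ u ∈ wordsOf p.2, ∑ w ∈ wordsOf p.1,
      (γ u * δ w) • X (u ++ w) = ∑ s ∈ wordsOf m, conv γ δ s • X s := by
  simp only [conv, Finset.sum_smul, ← Finset.sum_product']
  rw [Finset.sum_sigma', Finset.sum_sigma']
  refine Finset.sum_bij' (fun a _ => ⟨a.2.1 ++ a.2.2, a.2.1.length⟩)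
    (fun b _ => ⟨(Multiset.toFinsupp (b.1.drop b.2 : Multiset A),
      Multiset.toFinsupp (b.1.take b.2 : Multiset A)), (b.1.take b.2, b.1.drop b.2)⟩)
    ?_ ?_ ?_ ?_ ?_
  · rintro ⟨⟨p, q⟩, u, w⟩ h
    simp only [Finset.mem_sigma, Finset.mem_product, mem_wordsOf_iff_toFinsupp,
      Finset.HasAntidiagonal.mem_antidiagonal, Finset.mem_range, List.length_append] at h ⊢
    obtain ⟨h1, h2, h3⟩ := h
    refine ⟨?_, by omega⟩
    rw [← Multiset.coe_add, map_add, h2, h3, add_comm, h1]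
  · rintro ⟨s, j⟩ h
    simp only [Finset.mem_sigma, Finset.mem_product, mem_wordsOf_iff_toFinsupp,
      Finset.HasAntidiagonal.mem_antidiagonal, and_self, and_true] at h ⊢
    rw [add_comm, ← map_add, Multiset.coe_add, List.take_append_drop]
    exact h.1
  · rintro ⟨⟨p, q⟩, u, w⟩ h
    simp only [Finset.mem_sigma, Finset.mem_product, mem_wordsOf_iff_toFinsupp] at h
    simp [h.2.1, h.2.2]
  · rintro ⟨s, j⟩ h
    simp only [Finset.mem_sigma, Finset.mem_range] at h
    have : j ≤ s.length := by omega
    simp [this]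
  · rintro ⟨⟨p, q⟩, u, w⟩ _
    simp

variable {f : A → E → E}

theorem sum_opSeries_opSeries (hf : ∀ ℓ, ContDiff ℂ ∞ (f ℓ)) (γ δ : List A → ℂ) {ψ : E → E}
    (hψ : ContDiff ℂ ∞ ψ) (m : A →₀ ℕ) (x : E) :
    ∑ p ∈ Finset.HasAntidiagonal.antidiagonal m, opSeries f γ (opSeries f δ ψ p.1) p.2 x =
      opSeries f (conv γ δ) ψ m x := by
  rw [opSeries, ← sum_wordsOf_conv]
  refine Finset.sum_congr rfl fun p _ => Finset.sum_congr rfl fun u _ => ?_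
  have := wordOp_sum hf u (wordsOf p.1) δ (fun w => contDiff_wordOp hf w hψ) x
  refine (congrArg (γ u • ·) this).trans ?_
  simp only [Finset.smul_sum, wordOp_append, smul_smul]

theorem contDiff_opSeries (hf : ∀ ℓ, ContDiff ℂ ∞ (f ℓ)) (γ : List A → ℂ) {φ : E → E}
    (hφ : ContDiff ℂ ∞ φ) (m : A →₀ ℕ) : ContDiff ℂ ∞ (opSeries f γ φ m) :=
  ContDiff.sum fun w _ => (contDiff_wordOp hf w hφ).const_smul (γ w)

theorem opSeries_convOne (f : A → E → E) (φ : E → E) :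
    opSeries f convOne φ = FormalMap.const φ := by
  funext m x
  simp only [opSeries, FormalMap.const]
  split_ifs with hm
  · simp [hm, wordsOf_zero, convOne, wordOp]
  · refine Finset.sum_eq_zero fun w hw => ?_
    cases w with
    | nil =>
      rw [mem_wordsOf_iff_toFinsupp] at hw
      exact absurd (by simpa using hw.symm) hm
    | cons a w => simp [convOne]

theorem const_comp (h : E → E) (Ψ : FormalMap A E) :
    FormalMap.comp (FormalMap.const h) Ψ = FormalMap.substCoeff h Ψ := by
  funext m x
  rw [FormalMap.comp, Finset.sum_eq_single (0, m)]
  · rfl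
  · rintro ⟨p, q⟩ hpq hne
    have hp : p ≠ 0 := by
      rintro rfl
      rw [Finset.HasAntidiagonal.mem_antidiagonal, zero_add] at hpq
      exact hne (by simpa using hpq)
    have : FormalMap.const (A := A) h p = 0 := by
      funext y
      simp [FormalMap.const, hp]
    simp [FormalMap.substCoeff, this]
  · simp

theorem const_comp_opSeries (hf : ∀ ℓ, ContDiff ℂ ∞ (f ℓ)) {h φ : E → E} (hh : ContDiff ℂ ∞ h)
    (hφ : ContDiff ℂ ∞ φ) {γ : List A → ℂ} (hγ : γ ∈ shuffleGroup A) :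
    FormalMap.comp (FormalMap.const h) (opSeries f γ φ) = opSeries f γ fun y => h (φ y) := by
  rw [const_comp]
  funext m x
  exact substCoeff_opSeries hf hh hφ hγ m x

/-- The operators of the inner series act last and their words come first, so composition reverses
the order of the convolution factors. Only the inner coefficients need the shuffle relations. -/
theorem opSeries_comp_wordSeries (hf : ∀ ℓ, ContDiff ℂ ∞ (f ℓ)) {ψ : E → E}
    (hψ : ContDiff ℂ ∞ ψ) {γ : List A → ℂ} (hγ : γ ∈ shuffleGroup A) (δ : List A → ℂ) :
    FormalMap.comp (opSeries f δ ψ) (wordSeries f γ) = opSeries f (conv γ δ) ψ := by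
  funext m x
  rw [wordSeries_eq_opSeries, FormalMap.comp, ← sum_opSeries_opSeries hf γ δ hψ]
  exact Finset.sum_congr rfl fun p _ =>
    substCoeff_opSeries hf (contDiff_opSeries hf δ hψ p.1) contDiff_id hγ p.2 x

theorem wordSeries_comp_wordSeries (hf : ∀ ℓ, ContDiff ℂ ∞ (f ℓ)) {γ : List A → ℂ}
    (hγ : γ ∈ shuffleGroup A) (δ : List A → ℂ) :
    FormalMap.comp (wordSeries f δ) (wordSeries f γ) = wordSeries f (conv γ δ) := by
  rw [wordSeries_eq_opSeries f δ, opSeries_comp_wordSeries hf contDiff_id hγ,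
    wordSeries_eq_opSeries]

theorem extWordSeries_eq_opSeries {d : ℕ} (hf : ∀ ℓ, ContDiff ℂ ∞ (f ℓ))
    {φ : (Fin d → ℂ) → E → E} {v : Fin d → ℂ} (hφ : ContDiff ℂ ∞ (φ v)) {γ : List A → ℂ}
    (hγ : γ ∈ shuffleGroup A) : extWordSeries φ f (v, γ) = opSeries f γ (φ v) := by
  rw [extWordSeries, wordSeries_eq_opSeries]
  exact const_comp_opSeries hf hφ contDiff_id hγ

variable {d : ℕ} {ν : Fin d → A → ℂ} {g : Fin d → E → E} {φ : (Fin d → ℂ) → E → E}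

/-- Composing `E_w id` with `φ_v` gives `exp(ν^v_w) E_w φ_v`; this is where `Ξ_v` enters the product
of extended word series. -/
theorem IsPerturbedSystem.wordSeries_comp_opSeries [ProperSpace E] (hs : IsPerturbedSystem ν g f)
    (hφ : IsFlowFamily g φ) (v : Fin d → ℂ) {γ : List A → ℂ} (hγ : γ ∈ shuffleGroup A)
    (δ : List A → ℂ) :
    FormalMap.comp (wordSeries f δ) (opSeries f γ (φ v)) =
      opSeries f (conv γ (Xi ν v δ)) (φ v) := by
  funext m x
  rw [wordSeries_eq_opSeries, FormalMap.comp,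
    ← sum_opSeries_opSeries hs.smooth_f γ (Xi ν v δ) (hφ.smooth v)]
  refine Finset.sum_congr rfl fun p _ => ?_
  rw [substCoeff_opSeries hs.smooth_f (contDiff_opSeries hs.smooth_f δ contDiff_id p.1)
    (hφ.smooth v) hγ p.2 x]
  congr 1
  funext y
  refine Finset.sum_congr rfl fun w _ => ?_
  rw [hs.wordOp_apply_flow hφ v contDiff_id w y, smul_smul, Xi, mul_comm]
  rfl

theorem IsPerturbedSystem.wordSeries_comp_const_flow [ProperSpace E]
    (hs : IsPerturbedSystem ν g f) (hφ : IsFlowFamily g φ) (u : Fin d → ℂ) (δ : List A → ℂ) :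
    FormalMap.comp (wordSeries f δ) (FormalMap.const (φ u)) = opSeries f (Xi ν u δ) (φ u) := by
  rw [← opSeries_convOne f, hs.wordSeries_comp_opSeries hφ u convOne_mem_shuffleGroup,
    convOne_conv]

/-- If `Ξ_u` fixes `γ`, then the flow `φ_u` commutes with the word series of `γ`. -/
theorem IsPerturbedSystem.flow_commute [ProperSpace E] (hs : IsPerturbedSystem ν g f)
    (hφ : IsFlowFamily g φ) {u : Fin d → ℂ} {γ : List A → ℂ} (hγ : γ ∈ shuffleGroup A)
    (hu : Xi ν u γ = γ) :
    FormalMap.comp (FormalMap.const (φ u)) (wordSeries f γ) =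
      FormalMap.comp (wordSeries f γ) (FormalMap.const (φ u)) := by
  rw [hs.wordSeries_comp_const_flow hφ, hu]
  exact extWordSeries_eq_opSeries hs.smooth_f (hφ.smooth u) hγ

end Composition

theorem Xi_eq_self {A : Type*} {d : ℕ} {ν : Fin d → A → ℂ} {u : Fin d → ℂ} {γ : List A → ℂ}
    (h : ∀ w, Complex.exp (nuWord ν u w) ≠ 1 → γ w = 0) : Xi ν u γ = γ := by
  funext w
  by_cases hw : Complex.exp (nuWord ν u w) = 1
  · rw [Xi, hw, one_mul]
  · rw [Xi, h w hw, mul_zero]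

end

/-! ### The main theorem. -/

theorem theorem4 {A : Type*} [Countable A] [DecidableEq A] {d : ℕ} (ν : Fin d → A → ℂ)
    (v : Fin d → ℂ) (η : List A → ℂ) (hη : η ∈ shuffleGroup A) :
    ∃ κ ∈ shuffleGroup A, ∃ κinv ∈ shuffleGroup A, ∃ ηhat ∈ shuffleGroup A,
      conv κ κinv = convOne ∧ conv κinv κ = convOne ∧
      ηhat = conv (conv κ η) (Xi ν v κinv) ∧
      (v, ηhat) = extMul ν (extMul ν (0, κ) (v, η)) (0, κinv) ∧
      Xi ν v ηhat = ηhat ∧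
      ∀ (D : ℕ) (g : Fin d → (Fin D → ℂ) → (Fin D → ℂ)) (f : A → (Fin D → ℂ) → (Fin D → ℂ))
        (φ : (Fin d → ℂ) → (Fin D → ℂ) → (Fin D → ℂ)),
        IsPerturbedSystem ν g f → IsFlowFamily g φ →
          (FormalMap.comp (wordSeries f κ) (wordSeries f κinv) = FormalMap.const id ∧
            FormalMap.comp (wordSeries f κinv) (wordSeries f κ) = FormalMap.const id ∧
            FormalMap.comp (extWordSeries φ f (v, η)) (wordSeries f κ) =
              FormalMap.comp (wordSeries f κ) (extWordSeries φ f (v, ηhat))) ∧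
          (extWordSeries φ f (v, ηhat) =
              FormalMap.comp (FormalMap.const (φ v)) (wordSeries f ηhat) ∧
            FormalMap.comp (FormalMap.const (φ v)) (wordSeries f ηhat) =
              FormalMap.comp (wordSeries f ηhat) (FormalMap.const (φ v))) ∧
          ∀ u : Fin d → ℂ,
            (∀ w : List A, Complex.exp (nuWord ν v w) = 1 → Complex.exp (nuWord ν u w) = 1) →
            FormalMap.comp (FormalMap.const (φ u)) (wordSeries f ηhat) =
              FormalMap.comp (wordSeries f ηhat) (FormalMap.const (φ u)) := by
  obtain ⟨κ, hκ, ηhat, hηhat, hconj, hres⟩ := exists_resonant_normalForm ν v hη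
  have hinv := convInv_mem_shuffleGroup hκ
  have heq : ηhat = conv (conv κ η) (Xi ν v (convInv κ)) := by
    rw [← hconj, conv_assoc, ← Xi_conv, conv_convInv hκ.1, Xi_convOne, conv_convOne]
  have hfix : Xi ν v ηhat = ηhat := Xi_eq_self hres
  refine ⟨κ, hκ, convInv κ, hinv, ηhat, hηhat, conv_convInv hκ.1, convInv_conv hκ.1, heq, ?_, hfix,
    fun D g f φ hs hφ => ⟨⟨?_, ?_, ?_⟩, ⟨rfl, hs.flow_commute hφ hηhat hfix⟩, fun u hu =>
      hs.flow_commute hφ hηhat (Xi_eq_self fun w hw => hres w fun h1 => hw (hu w h1))⟩⟩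
  · simp [extMul, Xi_zero, heq, hinv.1]
  · rw [wordSeries_comp_wordSeries hs.smooth_f hinv, convInv_conv hκ.1, wordSeries_eq_opSeries,
      opSeries_convOne]
  · rw [wordSeries_comp_wordSeries hs.smooth_f hκ, conv_convInv hκ.1, wordSeries_eq_opSeries,
      opSeries_convOne]
  -- Both sides become `opSeries` of `φ v`, with coefficients `conv κ η` and `conv ηhat (Xi ν v κ)`.
  · rw [extWordSeries_eq_opSeries hs.smooth_f (hφ.smooth v) hη,
      extWordSeries_eq_opSeries hs.smooth_f (hφ.smooth v) hηhat,
      opSeries_comp_wordSeries hs.smooth_f (hφ.smooth v) hκ,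
      hs.wordSeries_comp_opSeries hφ v hηhat, hconj]
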